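/- Lemma 4.3. Let $n\ge 1$, $1\le k\le n$, let $\mathbb H^n$ be hyperbolic space of curvature $-1$ with metric $g$, and let $\Omega\subset\mathbb H^n$ be a bounded $C^2$ domain with outer unit normal $\gamma$. Fix a point $p\in\mathbb H^n$, let $r$ be the hyperbolic distance from $p$, and put $V=\cosh r$. Denote by $Du$ and $D^2u$ the gradient and Hessian with respect to $g$, by $u_i,u_{ij},V_i,\dots$ covariant derivatives, by $\mathrm dx$ the Riemannian volume, by $\mathrm d\sigma$ the induced hypersurface measure on $\partial\Omega$, by $C_n^k$ the binomial coefficient, by $\sigma_k(A)$ the $k$-th elementary symmetric function of the eigenvalues of $A$ (with $\sigma_0=1$), and put $\sigma_k^{ij}(A)=\partial\sigma_k(A)/\partial a_{ij}$, where components are taken in an orthonormal frame and repeated indices are summed. Let $u\in C^3(\Omega)\cap C^2(\overline\Omega)$ satisfy $$\sigma_k(D^2u-uI)=C_n^k\ \text{ in }\Omega,\qquad u=0\ \text{ on }\partial\Omega.$$ Then $$\frac12\int_{\partial\Omega}\sigma_k^{ij}(D^2u-uI)\,V_i\gamma_j\,|Du|^2\,\mathrm d\sigma=-\frac{n-k+1}2\int_\Omega\sigma_{k-1}(D^2u-uI)\,u^2\,V\,\mathrm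 dx-kC_n^k\int_\Omega uV\,\mathrm dx+\frac{n-k+1}2\int_\Omega\sigma_{k-1}(D^2u-uI)\,|Du|^2\,V\,\mathrm dx.$$ -/

import Mathlib

open MeasureTheory

noncomputable section

namespace HypPohozaev

/-- Coordinate space `ℝⁿ`. It is also the underlying set of the global chart of `ℍⁿ` used below. -/
abbrev E (n : ℕ) : Type := EuclideanSpace ℝ (Fin n)

/-- `i`-th partial derivative of `f` at `x`, relative to the set `S`. It depends only on `f` on `S`;
on the interior of `S` it is the usual one, and on the boundary of a `C²` domain with closure `S`
it is, for `f ∈ C¹(S)`, the continuous extension of the interior derivative. -/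
def pd {n : ℕ} (S : Set (E n)) (f : E n → ℝ) (i : Fin n) (x : E n) : ℝ :=
  fderivWithin ℝ f S x (EuclideanSpace.single i 1)

/-! ### Riemannian geometry in a global chart, for a metric `g = (g_ij)` on `ℝⁿ` -/

/-- Christoffel symbols `Γᵏ_ij = ½ gᵏˡ (∂_i g_jl + ∂_j g_il - ∂_l g_ij)` of the Levi-Civita
connection. -/
def christoffel {n : ℕ} (g : E n → Matrix (Fin n) (Fin n) ℝ) (k i j : Fin n) (x : E n) : ℝ :=
  (1 / 2) * ∑ l, (g x)⁻¹ k l *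
    (pd Set.univ (fun y => g y j l) i x + pd Set.univ (fun y => g y i l) j x
      - pd Set.univ (fun y => g y i j) l x)

/-- Covariant Hessian `u_ij = ∂_i ∂_j u - Γᵏ_ij ∂_k u`, as a `(0,2)`-tensor. -/
def hess {n : ℕ} (g : E n → Matrix (Fin n) (Fin n) ℝ) (S : Set (E n)) (u : E n → ℝ) (x : E n) :
    Matrix (Fin n) (Fin n) ℝ :=
  Matrix.of fun i j => pd S (pd S u j) i x - ∑ k, christoffel g k i j x * pd S u k x

/-- `|Du|² = gⁱʲ u_i u_j`. -/
def gradSq {n : ℕ} (g : E n → Matrix (Fin n) (Fin n) ℝ) (S : Set (E n)) (u : E n → ℝ) (x : E n) :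
    ℝ :=
  ∑ i, ∑ j, (g x)⁻¹ i j * pd S u i x * pd S u j x

/-- Riemannian volume measure `dx = √(det g) dx¹ ⋯ dxⁿ`. -/
def riemVolume {n : ℕ} (g : E n → Matrix (Fin n) (Fin n) ℝ) : Measure (E n) :=
  (volume : Measure (E n)).withDensity fun x => ENNReal.ofReal (Real.sqrt (g x).det)

/-! ### `C²` domains, outer normals, surface measure -/

/-- `ρ` is a `C²` defining function of `Ω` near the boundary point `x`: it is `C²` near `x` with
`dρ(x) ≠ 0`, and near `x` the set `Ω` is `{ρ < 0}`. -/
def IsLocalDefining {n : ℕ} (Ω : Set (E n)) (x : E n) (ρ : E n → ℝ) : Prop :=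
  ContDiffAt ℝ 2 ρ x ∧ gradient ρ x ≠ 0 ∧ ρ x = 0 ∧ ∀ᶠ y in nhds x, (y ∈ Ω ↔ ρ y < 0)

/-- The outer unit normal of `Ω` at the boundary point `x` in the coordinate Euclidean metric:
`∇ρ / |∇ρ|` for a local defining function `ρ` (it does not depend on the choice of `ρ`). -/
def euclNormal {n : ℕ} (Ω : Set (E n)) (x : E n) : E n :=
  Classical.epsilon fun ν => ∃ ρ, IsLocalDefining Ω x ρ ∧ ν = ‖gradient ρ x‖⁻¹ • gradient ρ x

/-- Components `γ_j` (index lowered with `g`) of the outer unit normal `γ` of `Ω` with respect to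
`g`: the positive multiple of the Euclidean conormal `ν` with `gⁱʲ γ_i γ_j = 1`. -/
def conormal {n : ℕ} (g : E n → Matrix (Fin n) (Fin n) ℝ) (Ω : Set (E n)) (x : E n) (j : Fin n) :
    ℝ :=
  euclNormal Ω x j / Real.sqrt (∑ a, ∑ b, (g x)⁻¹ a b * euclNormal Ω x a * euclNormal Ω x b)

/-- Orthogonal projection `P = I - ν νᵀ` of `ℝⁿ` onto the tangent hyperplane of the boundary. -/
def tangentProj {n : ℕ} (Ω : Set (E n)) (x : E n) : Matrix (Fin n) (Fin n) ℝ :=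
  1 - Matrix.of fun i j => euclNormal Ω x i * euclNormal Ω x j

/-- The Riemannian hypersurface measure `dσ` on `∂Ω` of the metric induced by `g`: the Euclidean
surface measure (normalized `(n-1)`-dimensional Hausdorff measure) on `∂Ω` times the square root of
the determinant of `g` restricted to the tangent hyperplane, in a Euclidean orthonormal basis of
it; this determinant equals `det (P g P + ν νᵀ)`. -/
def riemSurface {n : ℕ} (g : E n → Matrix (Fin n) (Fin n) ℝ) (Ω : Set (E n)) : Measure (E n) :=
  ((μHE[n - 1] : Measure (E n)).restrict (frontier Ω)).withDensity fun x =>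
    ENNReal.ofReal (Real.sqrt
      (tangentProj Ω x * g x * tangentProj Ω x
        + Matrix.of fun i j => euclNormal Ω x i * euclNormal Ω x j).det)

/-! ### Elementary symmetric functions -/

/-- `σ_k(A)`: the `k`-th elementary symmetric function of the eigenvalues of `A`, counted with
algebraic multiplicity. For a general real matrix these are complex, but `σ_k(A)` is real and is
a polynomial in the entries of `A`. -/
def sigma {n : ℕ} (k : ℕ) (A : Matrix (Fin n) (Fin n) ℝ) : ℝ :=
  ((A.map Complex.ofReal).charpoly.roots.esymm k).re

/-- For a `(0,2)`-tensor `h` and a metric `G` at a point, `σ_k(h)` is `σ_k` of the endomorphism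
`Gⁱˡ h_lj`; in a `G`-orthonormal frame, this is `σ_k` of the matrix of `h`. -/
def sigmaT {n : ℕ} (k : ℕ) (G h : Matrix (Fin n) (Fin n) ℝ) : ℝ :=
  sigma k (G⁻¹ * h)

/-- `σ_kⁱʲ(h) = ∂σ_k(h) / ∂h_ij`, a `(2,0)`-tensor; all entries of `h` are independent variables.
In a `G`-orthonormal frame this is the derivative of `σ_k` by the `(i,j)` matrix entry. -/
def sigmaD {n : ℕ} (k : ℕ) (G h : Matrix (Fin n) (Fin n) ℝ) (i j : Fin n) : ℝ :=
  deriv (fun t : ℝ => sigmaT k G (h + t • Matrix.single i j 1)) 0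

/-! ### Hyperbolic space

`ℍⁿ` is the upper sheet `{X₀² - |x|² = 1, X₀ > 0}` of the hyperboloid in Minkowski space
`ℝ × ℝⁿ`. The point over `x ∈ ℝⁿ` is `(√(1 + |x|²), x)`; this is a global chart with values in
all of `ℝⁿ`. With `x = sinh r · θ`, `|θ| = 1`, the induced metric is `dr² + sinh² r g_{S^{n-1}}`. -/

/-- Height `X₀` of the point of the hyperboloid over `x`. -/
def height {n : ℕ} (x : E n) : ℝ := Real.sqrt (1 + ‖x‖ ^ 2)

/-- The hyperbolic metric in the chart: the pull-back of `- dX₀² + |dx|²` by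
`x ↦ (height x, x)`. -/
def hypMetric {n : ℕ} (x : E n) : Matrix (Fin n) (Fin n) ℝ :=
  Matrix.of fun i j =>
    (if i = j then 1 else 0) - pd Set.univ height i x * pd Set.univ height j x

/-- Hyperbolic distance: `cosh d(x, y) = X₀ Y₀ - ⟨x, y⟩`, minus the Minkowski product of the two
points of the hyperboloid. -/
def hdist {n : ℕ} (x y : E n) : ℝ := Real.arcosh (height x * height y - inner ℝ x y)

/-- A bounded `C²` domain of `ℍⁿ`, seen in the chart. -/
structure IsBoundedC2Domain {n : ℕ} (Ω : Set (E n)) : Prop where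
  isOpen : IsOpen Ω
  isConnected : IsConnected Ω
  bounded : ∃ (c : E n) (R : ℝ), ∀ x ∈ Ω, hdist c x ≤ R
  boundary : ∀ x ∈ frontier Ω, ∃ ρ, IsLocalDefining Ω x ρ

/-- `V = cosh r`, with `r` the hyperbolic distance from `p`. -/
def V {n : ℕ} (p x : E n) : ℝ := Real.cosh (hdist p x)

/-- `D²u - u I` on `ℍⁿ` as the `(0,2)`-tensor `u_ij - u g_ij`. -/
def shiftedHess {n : ℕ} (S : Set (E n)) (u : E n → ℝ) (x : E n) : Matrix (Fin n) (Fin n) ℝ :=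
  hess hypMetric S u x - u x • hypMetric x

/-- `σ_k(D²u - u I)` on `ℍⁿ`. -/
def S_k {n : ℕ} (k : ℕ) (S : Set (E n)) (u : E n → ℝ) (x : E n) : ℝ :=
  sigmaT k (hypMetric x) (shiftedHess S u x)

/-- `σ_kⁱʲ(D²u - u I) V_i γ_j |Du|²` at a boundary point of `Ω`; the derivatives of `u` are those
of `u ∈ C²(closure Ω)`. -/
def boundaryIntegrand {n : ℕ} (k : ℕ) (Ω : Set (E n)) (u : E n → ℝ) (p x : E n) : ℝ :=
  (∑ i, ∑ j, sigmaD k (hypMetric x) (shiftedHess (closure Ω) u x) i j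
      * pd Set.univ (V p) i x * conormal hypMetric Ω x j)
    * gradSq hypMetric (closure Ω) u x

end HypPohozaev

end

/-!
Write `A = g⁻¹ (D²u - u g)`, let `T_k` be its Newton tensors, `C = σ_k(A)`, and let `Z = DV`, so that
`D²V = V g`. The identity is the divergence theorem for the vector field
`W = ½ (|Du|² - u²) T_{k-1}(Z) - C u Z + u T_k(Z)`.

Three facts give its divergence. The Codazzi equation for `D²u - u I` makes the Newton tensors
divergence free, so that `div (T_k Z) = V tr T_k = (n - k) σ_k V`. The derivative of
`½ (|Du|² - u²)` is `Aᵀ Du`. And `A T_{k-1} + T_k = σ_k I` makes the terms in which `Du` is paired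
with `Z` cancel against that of `- C u Z`. What is left is
`½ (n - k + 1) σ_{k-1} (|Du|² - u²) V - k C u V`. On the boundary `u = 0`, so only
`½ |Du|² T_{k-1}(Z)` contributes to the flux, and `T_{k-1} = ∂σ_k / ∂A` (`sigmaD_eq`).

In the hyperboloid chart, with `h² = 1 + |x|²`, the metric is `I - x xᵀ / h²`, its inverse is
`I + x xᵀ`, and the Riemannian divergence of `W` is `h` times the Euclidean divergence of `W / h`
(`pohozaevField`). There `A` is the Jacobian matrix of the map `∂u + x (x · ∂u - u)`
(`hessEnd_eq_fderiv`), which reduces the Codazzi equation to the symmetry of second derivatives; the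
Newton tensors are then divergence free by induction on `k` (`sum_fderiv_newton_eq_zero`). The
pointwise computation is `euclDiv_pohozaevField`, and the density of the hyperbolic surface measure
exactly turns the Riemannian flux of `W` into the Euclidean flux of `W / h`
(`boundaryIntegrand_eq`).

It remains to prove the divergence theorem on a bounded `C²` domain with the Hausdorff measure on
the boundary (`divergence_theorem`). Near a boundary point the domain lies on one side of a graph
over a coordinate hyperplane (`IsLocalDefining.exists_graph`). A volume preserving shear flattens
the graph, after which the divergence theorem on boxes applies (`setIntegral_euclDiv_graph`). The
boundary term is identified by the area formula for graphs (`map_graphMap`), and a smooth partition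
of unity patches the local statements together.
-/

noncomputable section

namespace HypPohozaev

/-! ### Elementary symmetric functions and Newton tensors -/

section NewtonTensors

open Polynomial Matrix

variable {n : ℕ}

/-- The matrix `1 + X A` over `ℝ[X]`. Its determinant generates the elementary symmetric functions
of the eigenvalues of `A`, its adjugate the Newton tensors of `A`. -/
def onePlusX (A : Matrix (Fin n) (Fin n) ℝ) : Matrix (Fin n) (Fin n) ℝ[X] :=
  1 + (X : ℝ[X]) • A.map C

/-- `σ_k(A)` as the coefficient of `t ^ k` in `det (1 + t A)`; a polynomial in the entries. -/
def esym (k : ℕ) (A : Matrix (Fin n) (Fin n) ℝ) : ℝ := (onePlusX A).det.coeff k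

/-- The `k`-th Newton tensor `T_k(A)`: the coefficient of `t ^ k` in the adjugate of `1 + t A`. -/
def newton (k : ℕ) (A : Matrix (Fin n) (Fin n) ℝ) : Matrix (Fin n) (Fin n) ℝ :=
  Matrix.of fun i j => ((onePlusX A).adjugate i j).coeff k

theorem sigma_eq_esym {k : ℕ} (hk : k ≤ n) (A : Matrix (Fin n) (Fin n) ℝ) :
    sigma k A = esym k A := by
  set B : Matrix (Fin n) (Fin n) ℂ := A.map Complex.ofReal
  have hcoeff : B.charpoly.coeff (n - k) = (-1) ^ k * B.charpoly.roots.esymm k := by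
    have h := coeff_eq_esymm_roots_of_card (p := B.charpoly)
      (splits_iff_card_roots.mp (IsAlgClosed.splits _)) (k := n - k)
      (by rw [charpoly_natDegree_eq_dim, Fintype.card_fin]; omega)
    rw [h, charpoly_natDegree_eq_dim, Fintype.card_fin, (charpoly_monic B).leadingCoeff,
      Nat.sub_sub_self hk, one_mul]
  have hmap : B.charpoly = A.charpoly.map Complex.ofRealHom := by
    rw [← charpoly_map]; rfl
  have hrev : A.charpoly.coeff (n - k) = A.charpolyRev.coeff k := by
    rw [← reverse_charpoly, coeff_reverse, charpoly_natDegree_eq_dim, Fintype.card_fin,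
      revAt_le hk]
  have hcomp : (onePlusX A).det = A.charpolyRev.comp (C (-1) * X) := by
    rw [charpolyRev, ← coe_compRingHom_apply, RingHom.map_det, onePlusX]
    congr 1
    ext i j : 1
    simp [Matrix.one_apply, apply_ite (fun p : ℝ[X] => p.comp (-X))]
  have hsig : B.charpoly.roots.esymm k = ((-1) ^ k * A.charpolyRev.coeff k : ℝ) := by
    rw [hmap, coeff_map, hrev] at hcoeff
    rw [Complex.ofReal_mul]
    change Complex.ofReal _ = _ at hcoeff
    rw [← hmap] at hcoeff
    rw [hcoeff, ← mul_assoc, ← Complex.ofReal_one, ← Complex.ofReal_neg, ← Complex.ofReal_pow,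
      ← Complex.ofReal_mul, ← mul_pow]
    simp
  change (B.charpoly.roots.esymm k).re = _
  rw [hsig, Complex.ofReal_re, esym, hcomp, comp_C_mul_X_coeff, mul_comm]

theorem esym_zero (A : Matrix (Fin n) (Fin n) ℝ) : esym 0 A = 1 := by
  rw [esym, coeff_zero_eq_eval_zero, ← coe_evalRingHom, RingHom.map_det, ← det_one (R := ℝ) (n := Fin n)]
  congr 1
  ext i j
  simp [onePlusX, Matrix.one_apply, apply_ite (fun p : ℝ[X] => p.eval 0)]

theorem newton_zero (A : Matrix (Fin n) (Fin n) ℝ) : newton 0 A = 1 := by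
  ext i j
  have h := congrFun (congrFun (mul_adjugate (onePlusX A)) i) j
  have h0 := congrArg (fun p : ℝ[X] => p.coeff 0) h
  simp only [onePlusX, Matrix.add_mul, Matrix.one_mul, Matrix.smul_mul, Matrix.add_apply,
    Matrix.smul_apply, smul_eq_mul, coeff_add, coeff_X_mul_zero, add_zero] at h0
  change newton 0 A i j = _ at h0
  rw [h0]
  have := esym_zero A
  rw [esym, onePlusX] at this
  by_cases hij : i = j
  · subst hij; simpa using this
  · simp [hij]

/-- `T_{k+1} + A T_k = σ_{k+1} I`: a coefficient of `(1 + t A) adj (1 + t A) = det (1 + t A)`. -/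
theorem newton_succ_add_mul (k : ℕ) (A : Matrix (Fin n) (Fin n) ℝ) :
    newton (k + 1) A + A * newton k A = esym (k + 1) A • 1 := by
  ext i j
  have h := congrFun (congrFun (mul_adjugate (onePlusX A)) i) j
  rw [onePlusX, Matrix.add_mul, Matrix.one_mul, Matrix.smul_mul, Matrix.add_apply,
    Matrix.smul_apply, ← onePlusX, Matrix.mul_apply, smul_eq_mul] at h
  have h0 := congrArg (fun p : ℝ[X] => p.coeff (k + 1)) h
  simp only [coeff_add, coeff_X_mul, finsetSum_coeff, Matrix.map_apply, coeff_C_mul] at h0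
  rw [Matrix.add_apply, Matrix.mul_apply]
  refine Eq.trans h0 ?_
  by_cases hij : i = j
  · subst hij; simp [esym]
  · simp [hij]

theorem newton_succ_add_mul' (k : ℕ) (A : Matrix (Fin n) (Fin n) ℝ) :
    newton (k + 1) A + newton k A * A = esym (k + 1) A • 1 := by
  ext i j
  have h := congrFun (congrFun (adjugate_mul (onePlusX A)) i) j
  rw [onePlusX, Matrix.mul_add, Matrix.mul_one, Matrix.mul_smul, Matrix.add_apply,
    Matrix.smul_apply, ← onePlusX, Matrix.mul_apply, smul_eq_mul] at h
  have h0 := congrArg (fun p : ℝ[X] => p.coeff (k + 1)) h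
  simp only [coeff_add, coeff_X_mul, finsetSum_coeff, Matrix.map_apply, coeff_mul_C] at h0
  rw [Matrix.add_apply, Matrix.mul_apply]
  refine Eq.trans h0 ?_
  by_cases hij : i = j
  · subst hij; simp [esym]
  · simp [hij]

/-- By Lagrange interpolation, a coefficient of a polynomial of bounded degree is a fixed linear
combination of its values at `0, 1, 2, …`. -/
theorem exists_coeff_eq_sum_eval (N k : ℕ) : ∃ c : ℕ → ℝ, ∀ p : ℝ[X], p.degree < (N : ℕ) →
    p.coeff k = ∑ l ∈ Finset.range N, c l * p.eval (l : ℝ) := by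
  refine ⟨fun l => (Lagrange.basis (Finset.range N) (fun l : ℕ => (l : ℝ)) l).coeff k, ?_⟩
  intro p hp
  have hinj : Set.InjOn (fun l : ℕ => (l : ℝ)) (Finset.range N : Set ℕ) :=
    Nat.cast_injective.injOn
  have h := Lagrange.eq_interpolate hinj (f := p) (by simpa using hp)
  conv_lhs => rw [h]
  rw [Lagrange.interpolate_apply, finsetSum_coeff]
  exact Finset.sum_congr rfl fun l _ => by rw [coeff_C_mul, mul_comm]

theorem eval_det_onePlusX (A : Matrix (Fin n) (Fin n) ℝ) (t : ℝ) :
    (onePlusX A).det.eval t = (1 + t • A).det := by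
  rw [← coe_evalRingHom, RingHom.map_det]
  congr 1
  ext i j
  simp [onePlusX, Matrix.one_apply, apply_ite (fun p : ℝ[X] => p.eval t)]
  exact mul_comm _ _

theorem eval_adjugate_onePlusX (A : Matrix (Fin n) (Fin n) ℝ) (t : ℝ) (i j : Fin n) :
    ((onePlusX A).adjugate i j).eval t = (1 + t • A).adjugate i j := by
  have h := (evalRingHom t).map_adjugate (onePlusX A)
  have h2 : (evalRingHom t).mapMatrix (onePlusX A) = 1 + t • A := by
    ext i j
    simp [onePlusX, Matrix.one_apply, apply_ite (fun p : ℝ[X] => p.eval t)]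
    exact mul_comm _ _
  rw [h2] at h
  exact congrFun (congrFun h i) j

theorem natDegree_det_onePlusX_le (A : Matrix (Fin n) (Fin n) ℝ) :
    (onePlusX A).det.natDegree ≤ n := by
  have h := natDegree_det_X_add_C_le A 1
  rw [Fintype.card_fin] at h
  rwa [onePlusX, add_comm, show (1 : Matrix (Fin n) (Fin n) ℝ[X]) = (1 : Matrix _ _ ℝ).map C by
    simp]

theorem natDegree_adjugate_onePlusX_le (A : Matrix (Fin n) (Fin n) ℝ) (i j : Fin n) :
    ((onePlusX A).adjugate i j).natDegree ≤ n := by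
  have h := natDegree_det_X_add_C_le (A.updateRow j 0)
    ((1 : Matrix (Fin n) (Fin n) ℝ).updateRow j (Pi.single i 1))
  rw [Fintype.card_fin] at h
  rw [adjugate_apply]
  suffices hM : (onePlusX A).updateRow j (Pi.single i 1) = (X : ℝ[X]) • (A.updateRow j 0).map C +
      ((1 : Matrix (Fin n) (Fin n) ℝ).updateRow j (Pi.single i 1)).map C by rwa [hM]
  ext a b : 2
  by_cases ha : a = j
  · subst ha
    simp [Pi.single_apply, apply_ite (C : ℝ → ℝ[X])]
  · simp [ha, onePlusX, add_comm, Matrix.one_apply, apply_ite (C : ℝ → ℝ[X])]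

/-- The elementary symmetric functions, and with the
same weights the Newton tensors, are fixed linear combinations of values of `det (1 + t A)` and
`adj (1 + t A)`. In the last formula, `t adj (1 + t A)` has `T_{k-1}` as its `k`-th coefficient. -/
theorem exists_nodes (n k : ℕ) : ∃ c : ℕ → ℝ,
    (∀ A : Matrix (Fin n) (Fin n) ℝ,
      esym k A = ∑ l ∈ Finset.range (n + 2), c l * (1 + (l : ℝ) • A).det) ∧
    (∀ (A : Matrix (Fin n) (Fin n) ℝ) (i j : Fin n),
      newton k A i j = ∑ l ∈ Finset.range (n + 2), c l * (1 + (l : ℝ) • A).adjugate i j) ∧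
    (∀ (A : Matrix (Fin n) (Fin n) ℝ) (i j : Fin n) (m : ℕ), k = m + 1 →
      newton m A i j = ∑ l ∈ Finset.range (n + 2),
        c l * ((l : ℝ) * (1 + (l : ℝ) • A).adjugate i j)) := by
  obtain ⟨c, hc⟩ := exists_coeff_eq_sum_eval (n + 2) k
  refine ⟨c, fun A => ?_, fun A i j => ?_, fun A i j m hm => ?_⟩
  · rw [esym, hc]
    · simp_rw [eval_det_onePlusX]
    · refine lt_of_le_of_lt degree_le_natDegree ?_
      exact_mod_cast (natDegree_det_onePlusX_le A).trans_lt (by omega)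
  · rw [newton, of_apply, hc]
    · simp_rw [eval_adjugate_onePlusX]
    · refine lt_of_le_of_lt degree_le_natDegree ?_
      exact_mod_cast (natDegree_adjugate_onePlusX_le A i j).trans_lt (by omega)
  · have h := hc (X * (onePlusX A).adjugate i j) (by
      refine lt_of_le_of_lt degree_le_natDegree ?_
      have := (natDegree_mul_le (p := X) (q := (onePlusX A).adjugate i j))
      have h2 := natDegree_adjugate_onePlusX_le A i j
      rw [natDegree_X] at this
      exact_mod_cast this.trans_lt (by omega))
    rw [hm, coeff_X_mul] at h
    rw [newton, of_apply, h]
    simp_rw [eval_mul, eval_X, eval_adjugate_onePlusX]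

end NewtonTensors

/-! ### Derivatives of elementary symmetric functions and Newton tensors -/

section NewtonDerivatives

open Polynomial Matrix
variable {n : ℕ}

/-- Jacobi's formula along a curve of matrices. -/
theorem hasDerivAt_det {A : ℝ → Matrix (Fin n) (Fin n) ℝ} {A' : Matrix (Fin n) (Fin n) ℝ} {s : ℝ}
    (hA : ∀ i j, HasDerivAt (fun r => A r i j) (A' i j) s) :
    HasDerivAt (fun r => (A r).det) ((A s).adjugate * A').trace s := by
  have hA2 : HasDerivAt (fun r i j => A r i j) (fun i j => A' i j) s :=
    hasDerivAt_pi.2 fun i => hasDerivAt_pi.2 fun j => hA i j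
  let f : ContinuousMultilinearMap ℝ (fun _ : Fin n => Fin n → ℝ) ℝ :=
    { (detRowAlternating : (Fin n → ℝ) [⋀^Fin n]→ₗ[ℝ] ℝ).toMultilinearMap with
      cont := (continuous_id.matrix_det : Continuous fun M : Matrix (Fin n) (Fin n) ℝ => M.det) }
  have h := (f.hasFDerivAt (fun i j => A s i j)).comp_hasDerivAt s hA2
  refine h.congr_deriv ?_
  refine (ContinuousMultilinearMap.linearDeriv_apply f _ _).trans ?_
  rw [trace_mul_comm, trace]
  refine Finset.sum_congr rfl fun i _ => ?_
  change ((A s).updateRow i (A' i)).det = _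
  rw [diag_apply, mul_apply, ← cramer_transpose_apply, cramer_eq_adjugate_mulVec, mulVec, dotProduct,
    ← adjugate_transpose]
  exact Finset.sum_congr rfl fun j _ => by rw [transpose_apply, mul_comm]

/-- `dσ_{k+1}(A) = tr (T_k(A) dA)`. -/
theorem hasDerivAt_esym (k : ℕ) {A : ℝ → Matrix (Fin n) (Fin n) ℝ} {A' : Matrix (Fin n) (Fin n) ℝ}
    {s : ℝ} (hA : ∀ i j, HasDerivAt (fun r => A r i j) (A' i j) s) :
    HasDerivAt (fun r => esym (k + 1) (A r)) (newton k (A s) * A').trace s := by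
  obtain ⟨c, h1, -, h3⟩ := exists_nodes n (k + 1)
  simp_rw [h1]
  have hd : ∀ l ∈ Finset.range (n + 2), HasDerivAt (fun r => c l * (1 + (l : ℝ) • A r).det)
      (c l * ((1 + (l : ℝ) • A s).adjugate * ((l : ℝ) • A')).trace) s := fun l _ =>
    (hasDerivAt_det fun i j => ((hA i j).const_mul (l : ℝ)).const_add _).const_mul _
  refine (HasDerivAt.fun_sum hd).congr_deriv ?_
  simp only [trace, diag_apply, mul_apply, h3 _ _ _ k rfl, Finset.mul_sum, Finset.sum_mul,
    Matrix.smul_apply, smul_eq_mul]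
  rw [Finset.sum_comm]
  refine Finset.sum_congr rfl fun i _ => ?_
  rw [Finset.sum_comm]
  exact Finset.sum_congr rfl fun j _ => Finset.sum_congr rfl fun l _ => by ring

theorem esym_smul (k : ℕ) (r : ℝ) (A : Matrix (Fin n) (Fin n) ℝ) :
    esym k (r • A) = r ^ k * esym k A := by
  have : (onePlusX (r • A)).det = (onePlusX A).det.comp (C r * X) := by
    rw [← coe_compRingHom_apply, RingHom.map_det]
    congr 1
    ext i j : 1
    simp [onePlusX, Matrix.one_apply, apply_ite (fun p : ℝ[X] => p.comp (C r * X))]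
    ring
  rw [esym, this, comp_C_mul_X_coeff, mul_comm, esym]

/-- Euler's identity for the homogeneous polynomial `σ_{k+1}`. -/
theorem trace_newton_mul_self (k : ℕ) (A : Matrix (Fin n) (Fin n) ℝ) :
    (newton k A * A).trace = ((k : ℝ) + 1) * esym (k + 1) A := by
  have h1 : HasDerivAt (fun r : ℝ => esym (k + 1) (r • A)) (newton k A * A).trace 1 := by
    have := hasDerivAt_esym k (A := fun r : ℝ => r • A) (A' := A) (s := 1) fun i j => by
      simpa using (hasDerivAt_id (1 : ℝ)).mul_const (A i j)
    simpa using this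
  have h2 : HasDerivAt (fun r : ℝ => esym (k + 1) (r • A)) (((k : ℝ) + 1) * esym (k + 1) A) 1 := by
    simp_rw [esym_smul]
    simpa using (hasDerivAt_pow (k + 1) (1 : ℝ)).mul_const (esym (k + 1) A)
  exact h1.unique h2

theorem trace_newton (k : ℕ) (A : Matrix (Fin n) (Fin n) ℝ) :
    (newton k A).trace = ((n : ℝ) - k) * esym k A := by
  cases k with
  | zero => simp [newton_zero, esym_zero]
  | succ k =>
    have h := congrArg trace (newton_succ_add_mul' k A)
    rw [trace_add, trace_newton_mul_self, trace_smul, trace_one, Fintype.card_fin, smul_eq_mul] at h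
    push_cast
    linarith

/-- `σ_kⁱʲ` is the Newton tensor `T_{k-1}` with an index raised. -/
theorem sigmaD_eq {k : ℕ} (hk : k + 1 ≤ n) (G h : Matrix (Fin n) (Fin n) ℝ) (i j : Fin n) :
    sigmaD (k + 1) G h i j = (newton k (G⁻¹ * h) * G⁻¹) j i := by
  have hd := hasDerivAt_esym k (A := fun t : ℝ => G⁻¹ * (h + t • Matrix.single i j 1))
    (A' := G⁻¹ * Matrix.single i j 1) (s := 0) fun a b => by
      simp only [Matrix.mul_add, Matrix.mul_smul, Matrix.add_apply, Matrix.smul_apply, smul_eq_mul]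
      simpa using ((hasDerivAt_id (0 : ℝ)).mul_const
        ((G⁻¹ * Matrix.single i j 1 : Matrix _ _ ℝ) a b)).const_add ((G⁻¹ * h : Matrix _ _ ℝ) a b)
  simp only [sigmaD, sigmaT, sigma_eq_esym hk]
  rw [hd.deriv]
  simp [← Matrix.mul_assoc, Matrix.trace_mul_single]

theorem continuous_esym (k : ℕ) : Continuous (esym (n := n) k) := by
  obtain ⟨c, h1, -, -⟩ := exists_nodes n k
  simp_rw [funext h1]
  fun_prop

theorem continuous_newton (k : ℕ) : Continuous (newton (n := n) k) := by
  obtain ⟨c, -, h2, -⟩ := exists_nodes n k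
  refine continuous_matrix fun i j => ?_
  simp_rw [h2]
  refine continuous_finsetSum _ fun l _ => continuous_const.mul ?_
  exact (Continuous.matrix_adjugate (by fun_prop)).matrix_elem i j

variable {F : Type*} [NormedAddCommGroup F] [NormedSpace ℝ F]

theorem differentiableAt_det {A : F → Matrix (Fin n) (Fin n) ℝ} {x : F}
    (hA : ∀ i j, DifferentiableAt ℝ (fun y => A y i j) x) :
    DifferentiableAt ℝ (fun y => (A y).det) x := by
  simp_rw [det_apply]
  refine DifferentiableAt.fun_sum fun σ _ => DifferentiableAt.const_smul ?_ _
  exact (HasFDerivAt.finsetProd fun i _ => (hA (σ i) i).hasFDerivAt).differentiableAt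

theorem differentiableAt_esym (k : ℕ) {A : F → Matrix (Fin n) (Fin n) ℝ} {x : F}
    (hA : ∀ i j, DifferentiableAt ℝ (fun y => A y i j) x) :
    DifferentiableAt ℝ (fun y => esym k (A y)) x := by
  obtain ⟨c, h1, -, -⟩ := exists_nodes n k
  simp_rw [h1]
  exact DifferentiableAt.fun_sum fun l _ => (differentiableAt_det fun i j =>
    ((hA i j).const_mul (l : ℝ)).const_add _).const_mul _

theorem differentiableAt_newton (k : ℕ) {A : F → Matrix (Fin n) (Fin n) ℝ} {x : F}
    (hA : ∀ i j, DifferentiableAt ℝ (fun y => A y i j) x) (i j : Fin n) :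
    DifferentiableAt ℝ (fun y => newton k (A y) i j) x := by
  induction k generalizing i j with
  | zero => simp [newton_zero]
  | succ k ih =>
    have h : ∀ y, newton (k + 1) (A y) i j = esym (k + 1) (A y) * (1 : Matrix (Fin n) (Fin n) ℝ) i j
        - ∑ l, newton k (A y) i l * A y l j := fun y => by
      rw [eq_sub_iff_add_eq, ← Matrix.mul_apply, ← Matrix.add_apply, newton_succ_add_mul',
        Matrix.smul_apply, smul_eq_mul]
    simp_rw [h]
    exact ((differentiableAt_esym _ hA).mul_const _).sub
      (DifferentiableAt.fun_sum fun l _ => (ih i l).mul (hA l j))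

/-- `σ_{k+1}(A(x))` has the directional derivative `tr (T_k(A) ∂_v A)`. -/
theorem fderiv_esym (k : ℕ) {A : F → Matrix (Fin n) (Fin n) ℝ} {x : F}
    (hA : ∀ i j, DifferentiableAt ℝ (fun y => A y i j) x) (v : F) :
    fderiv ℝ (fun y => esym (k + 1) (A y)) x v =
      ∑ i, ∑ j, newton k (A x) i j * fderiv ℝ (fun y => A y j i) x v := by
  have hline : HasDerivAt (fun t : ℝ => x + t • v) v 0 := by
    simpa using ((hasDerivAt_id (0 : ℝ)).smul_const v).const_add x
  have h1 := (differentiableAt_esym (k + 1) hA).hasFDerivAt.comp_hasDerivAt_of_eq 0 hline (by simp)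
  have h2 := hasDerivAt_esym k (A := fun t : ℝ => A (x + t • v))
    (A' := Matrix.of fun i j => fderiv ℝ (fun y => A y i j) x v) (s := 0)
    fun i j => (hA i j).hasFDerivAt.comp_hasDerivAt_of_eq 0 hline (by simp)
  rw [show A (x + (0 : ℝ) • v) = A x by simp] at h2
  have h := h1.unique h2
  rw [h]
  simp [trace, mul_apply]

/-- **Piola identity.** If the matrix field `A` has symmetric derivative `∂_i A_lj = ∂_j A_li`, as
the Jacobian matrix of a `C²` map does, then its Newton tensors are divergence free. -/
theorem sum_fderiv_newton_eq_zero (k : ℕ) {A : F → Matrix (Fin n) (Fin n) ℝ} {x : F}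
    (hA : ∀ i j, DifferentiableAt ℝ (fun y => A y i j) x) (e : Fin n → F)
    (hsymm : ∀ i j l, fderiv ℝ (fun y => A y l j) x (e i) = fderiv ℝ (fun y => A y l i) x (e j))
    (j : Fin n) : ∑ i, fderiv ℝ (fun y => newton k (A y) i j) x (e i) = 0 := by
  induction k generalizing j with
  | zero => simp [newton_zero]
  | succ k ih =>
    have h : ∀ i j y, newton (k + 1) (A y) i j = esym (k + 1) (A y) * (1 : Matrix (Fin n) (Fin n) ℝ) i j
        - ∑ l, newton k (A y) i l * A y l j := fun i j y => by
      rw [eq_sub_iff_add_eq, ← Matrix.mul_apply, ← Matrix.add_apply, newton_succ_add_mul',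
        Matrix.smul_apply, smul_eq_mul]
    have hd : ∀ i, fderiv ℝ (fun y => newton (k + 1) (A y) i j) x (e i) =
        fderiv ℝ (fun y => esym (k + 1) (A y)) x (e i) * (1 : Matrix (Fin n) (Fin n) ℝ) i j -
        ∑ l, (newton k (A x) i l * fderiv ℝ (fun y => A y l j) x (e i) +
          A x l j * fderiv ℝ (fun y => newton k (A y) i l) x (e i)) := by
      intro i
      simp_rw [h i j]
      have := (((differentiableAt_esym (k + 1) hA).hasFDerivAt.mul_const
        ((1 : Matrix (Fin n) (Fin n) ℝ) i j)).sub (HasFDerivAt.fun_sum (u := Finset.univ) fun l _ =>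
        (differentiableAt_newton k hA i l).hasFDerivAt.mul (hA l j).hasFDerivAt)).fderiv
      refine (DFunLike.congr_fun this (e i)).trans ?_
      simp [mul_comm]
    simp_rw [hd, Finset.sum_sub_distrib, Finset.sum_add_distrib]
    have h1 : ∑ i, fderiv ℝ (fun y => esym (k + 1) (A y)) x (e i) *
        (1 : Matrix (Fin n) (Fin n) ℝ) i j = fderiv ℝ (fun y => esym (k + 1) (A y)) x (e j) := by
      simp [Matrix.one_apply]
    have h2 : ∑ i, ∑ l, A x l j * fderiv ℝ (fun y => newton k (A y) i l) x (e i) = 0 := by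
      rw [Finset.sum_comm]
      simp_rw [← Finset.mul_sum, ih, mul_zero, Finset.sum_const_zero]
    rw [h1, h2, fderiv_esym k hA, add_zero, sub_eq_zero]
    exact Finset.sum_congr rfl fun i _ => Finset.sum_congr rfl fun l _ => by rw [hsymm j i l]

end NewtonDerivatives

/-! ### The hyperboloid chart -/

section HyperbolicChart

open Matrix
variable {n : ℕ}

theorem height_pos (x : E n) : 0 < height x := by unfold height; positivity

theorem height_sq (x : E n) : height x ^ 2 = 1 + ∑ i, x i ^ 2 := by
  rw [height, Real.sq_sqrt (by positivity), EuclideanSpace.real_norm_sq_eq]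

theorem hasFDerivAt_height (x : E n) :
    HasFDerivAt height ((height x)⁻¹ • innerSL ℝ x) x := by
  have h1 : HasFDerivAt (fun y : E n => 1 + ‖y‖ ^ 2) ((2 : ℝ) • innerSL ℝ x) x := by
    have := ((hasStrictFDerivAt_norm_sq x).hasFDerivAt).const_add 1
    refine this.congr_fderiv ?_
    ext v
    simp
  have h2 := h1.sqrt (by positivity)
  convert! h2 using 1
  rw [smul_smul]
  congr 1
  rw [height]
  field_simp

theorem pd_univ (f : E n → ℝ) (i : Fin n) (x : E n) :
    pd Set.univ f i x = fderiv ℝ f x (EuclideanSpace.single i 1) := by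
  rw [pd, fderivWithin_univ]

theorem pd_height (i : Fin n) (x : E n) : pd Set.univ height i x = x i / height x := by
  rw [pd_univ, (hasFDerivAt_height x).fderiv]
  simp [EuclideanSpace.inner_single_right, div_eq_inv_mul]

theorem hypMetric_apply (x : E n) (i j : Fin n) :
    hypMetric x i j = (1 : Matrix (Fin n) (Fin n) ℝ) i j - x i * x j / height x ^ 2 := by
  simp only [hypMetric, of_apply, pd_height, Matrix.one_apply]
  have := (height_pos x).ne'
  field_simp

/-- The inverse `I + x xᵀ` of the hyperbolic metric in the hyperboloid chart. -/
def hypInv (x : E n) : Matrix (Fin n) (Fin n) ℝ := Matrix.of fun i j =>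
  (1 : Matrix (Fin n) (Fin n) ℝ) i j + x i * x j

theorem hypInv_apply (x : E n) (i j : Fin n) :
    hypInv x i j = (1 : Matrix (Fin n) (Fin n) ℝ) i j + x i * x j := rfl

theorem hypInv_mul_hypMetric (x : E n) : hypInv x * hypMetric x = 1 := by
  ext i j
  rw [mul_apply]
  simp only [hypInv_apply, hypMetric_apply]
  have h : ∀ l, ((1 : Matrix (Fin n) (Fin n) ℝ) i l + x i * x l) *
      ((1 : Matrix (Fin n) (Fin n) ℝ) l j - x l * x j / height x ^ 2) =
      (1 : Matrix (Fin n) (Fin n) ℝ) i l * (1 : Matrix (Fin n) (Fin n) ℝ) l j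
      - (1 : Matrix (Fin n) (Fin n) ℝ) i l * (x l * x j / height x ^ 2)
      + x i * (x l * (1 : Matrix (Fin n) (Fin n) ℝ) l j)
      - x i * x j / height x ^ 2 * x l ^ 2 := fun l => by ring
  simp_rw [h, Finset.sum_sub_distrib, Finset.sum_add_distrib, Finset.sum_sub_distrib,
    ← Finset.mul_sum]
  have hs : ∑ l, x l ^ 2 = height x ^ 2 - 1 := by rw [height_sq]; ring
  rw [hs]
  have := (height_pos x).ne'
  simp [Matrix.one_apply]
  field_simp
  ring

theorem hypMetric_inv (x : E n) : (hypMetric x)⁻¹ = hypInv x :=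
  inv_eq_left_inv (hypInv_mul_hypMetric x)

theorem hypMetric_mul_hypInv (x : E n) : hypMetric x * hypInv x = 1 :=
  mul_eq_one_comm.1 (hypInv_mul_hypMetric x)

theorem det_hypMetric (x : E n) : (hypMetric x).det = (height x ^ 2)⁻¹ := by
  have h : (hypInv x).det = height x ^ 2 := by
    rw [show hypInv x = 1 + replicateCol Unit (⇑x) * replicateRow Unit (⇑x) by
      ext i j; simp [hypInv_apply, mul_apply]]
    rw [det_one_add_replicateCol_mul_replicateRow, height_sq, dotProduct]
    simp_rw [sq]
  have h2 := congrArg det (hypInv_mul_hypMetric x)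
  rw [det_mul, h, det_one] at h2
  exact eq_inv_of_mul_eq_one_right h2

theorem sqrt_det_hypMetric (x : E n) : Real.sqrt (hypMetric x).det = (height x)⁻¹ := by
  rw [det_hypMetric, ← inv_pow, Real.sqrt_sq (inv_nonneg.2 (height_pos x).le)]

theorem hasFDerivAt_coord (i : Fin n) (x : E n) :
    HasFDerivAt (fun y : E n => y i) (EuclideanSpace.proj i : E n →L[ℝ] ℝ) x :=
  (EuclideanSpace.proj i : E n →L[ℝ] ℝ).hasFDerivAt

theorem pd_hypMetric (x : E n) (i j l : Fin n) :
    pd Set.univ (fun y => hypMetric y i j) l x =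
      - ((1 : Matrix (Fin n) (Fin n) ℝ) i l * x j + x i * (1 : Matrix (Fin n) (Fin n) ℝ) j l)
        / height x ^ 2 + 2 * x i * x j * x l / height x ^ 4 := by
  have hne := (height_pos x).ne'
  have h := (((hasFDerivAt_coord i x).mul (hasFDerivAt_coord j x)).mul
    ((((hasDerivAt_pow 2 (height x)).inv (by positivity)).comp_hasFDerivAt x
      (hasFDerivAt_height x)))).const_sub ((1 : Matrix (Fin n) (Fin n) ℝ) i j)
  rw [pd_univ]
  simp_rw [hypMetric_apply, div_eq_mul_inv]
  refine (DFunLike.congr_fun h.fderiv _).trans ?_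
  simp [EuclideanSpace.inner_single_right, Matrix.one_apply]
  split_ifs <;> field_simp <;> ring

/-- Equivalently, the coordinate functions satisfy `D²xᵏ = xᵏ g`. -/
theorem christoffel_hypMetric (k i j : Fin n) (x : E n) :
    christoffel hypMetric k i j x = - x k * hypMetric x i j := by
  have hne := (height_pos x).ne'
  have h : ∀ l, pd Set.univ (fun y => hypMetric y j l) i x + pd Set.univ (fun y => hypMetric y i l) j x
      - pd Set.univ (fun y => hypMetric y i j) l x = - 2 * hypMetric x i j / height x ^ 2 * x l := by
    intro l
    rw [pd_hypMetric, pd_hypMetric, pd_hypMetric, hypMetric_apply]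
    rw [show (1 : Matrix (Fin n) (Fin n) ℝ) j i = (1 : Matrix (Fin n) (Fin n) ℝ) i j by
        simp [Matrix.one_apply, eq_comm],
      show (1 : Matrix (Fin n) (Fin n) ℝ) l i = (1 : Matrix (Fin n) (Fin n) ℝ) i l by
        simp [Matrix.one_apply, eq_comm],
      show (1 : Matrix (Fin n) (Fin n) ℝ) l j = (1 : Matrix (Fin n) (Fin n) ℝ) j l by
        simp [Matrix.one_apply, eq_comm]]
    field_simp
    ring
  unfold christoffel
  simp_rw [h, hypMetric_inv, hypInv_apply]
  have h2 : ∀ l, ((1 : Matrix (Fin n) (Fin n) ℝ) k l + x k * x l) *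
      (-2 * hypMetric x i j / height x ^ 2 * x l) = -2 * hypMetric x i j / height x ^ 2 *
      ((1 : Matrix (Fin n) (Fin n) ℝ) k l * x l + x k * x l ^ 2) := fun l => by ring
  simp_rw [h2, ← Finset.mul_sum, Finset.sum_add_distrib, ← Finset.mul_sum]
  have hs : ∑ l, x l ^ 2 = height x ^ 2 - 1 := by rw [height_sq]; ring
  rw [hs]
  simp [Matrix.one_apply]
  field_simp
  ring

/-! ### The function `V` and its gradient -/

theorem norm_lt_height (x : E n) : ‖x‖ < height x :=
  Real.lt_sqrt_of_sq_lt (by linarith)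

/-- Reversed Cauchy-Schwarz inequality in Minkowski space; it makes `hdist` a genuine `arcosh`. -/
theorem one_le_height_mul_sub_inner (p x : E n) : 1 ≤ height p * height x - inner ℝ p x := by
  have h1 := real_inner_le_norm p x
  have h2 : (1 + ‖p‖ * ‖x‖) ≤ height p * height x := by
    rw [height, height, ← Real.sqrt_mul (by positivity)]
    refine Real.le_sqrt_of_sq_le ?_
    nlinarith [sq_nonneg (‖p‖ - ‖x‖)]
  linarith

theorem V_eq (p x : E n) : V p x = height p * height x - ∑ i, p i * x i := by
  rw [V, hdist, Real.cosh_arcosh (one_le_height_mul_sub_inner p x), PiLp.inner_apply]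
  simp [mul_comm]

theorem hasFDerivAt_V (p x : E n) :
    HasFDerivAt (V p) ((height p / height x) • innerSL ℝ x - innerSL ℝ p) x := by
  have h : V p = fun y => height p * height y - innerSL ℝ p y := by
    ext y; rw [V_eq, innerSL_apply_apply, PiLp.inner_apply]; simp [mul_comm]
  rw [h]
  refine (((hasFDerivAt_height x).const_mul (height p)).sub (innerSL ℝ p).hasFDerivAt).congr_fderiv ?_
  rw [smul_smul, div_eq_mul_inv]

theorem pd_V (p x : E n) (i : Fin n) :
    pd Set.univ (V p) i x = height p * x i / height x - p i := by
  rw [pd_univ, (hasFDerivAt_V p x).fderiv]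
  simp [EuclideanSpace.inner_single_right]
  ring

/-- The components `V x_i - p_i` of the Riemannian gradient of `V` in the chart. -/
def gradV (p x : E n) (i : Fin n) : ℝ := V p x * x i - p i

theorem hypInv_mulVec_pd_V (p x : E n) :
    hypInv x *ᵥ (fun i => pd Set.univ (V p) i x) = gradV p x := by
  ext i
  have hne := (height_pos x).ne'
  simp only [mulVec, dotProduct, hypInv_apply, pd_V, gradV, V_eq]
  have h : ∀ l, ((1 : Matrix (Fin n) (Fin n) ℝ) i l + x i * x l) *
      (height p * x l / height x - p l) =
      (1 : Matrix (Fin n) (Fin n) ℝ) i l * (height p * x l / height x - p l) +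
      (x i * height p / height x * x l ^ 2 - x i * (p l * x l)) := fun l => by ring
  simp_rw [h, Finset.sum_add_distrib, Finset.sum_sub_distrib, ← Finset.mul_sum]
  have hs : ∑ l, x l ^ 2 = height x ^ 2 - 1 := by rw [height_sq]; ring
  rw [hs]
  simp [Matrix.one_apply]
  field_simp
  ring

/-! ### The surface density -/

/-- `det (P g P + ν νᵀ) = det g · (νᵀ g⁻¹ ν)` for the orthogonal projection `P` along a unit
vector `ν`. -/
theorem det_tangential {G G' : Matrix (Fin n) (Fin n) ℝ} (hG : G' * G = 1) {v : Fin n → ℝ}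
    (hv : v ⬝ᵥ v = 1) :
    ((1 - Matrix.of fun i j => v i * v j) * G * (1 - Matrix.of fun i j => v i * v j)
      + Matrix.of fun i j => v i * v j).det = G.det * (v ⬝ᵥ G' *ᵥ v) := by
  set N : Matrix (Fin n) (Fin n) ℝ := Matrix.of fun i j => v i * v j with hN
  have hNv : N = vecMulVec v v := by ext i j; simp [hN, vecMulVec_apply]
  have hNN : N * N = N := by rw [hNv, vecMulVec_mul_vecMulVec, hv, one_smul]
  set P : Matrix (Fin n) (Fin n) ℝ := 1 - N with hP
  have hNP : N * P = 0 := by rw [hP, mul_sub, mul_one, hNN, sub_self]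
  -- Adding the block `P G N` is a unipotent operation and does not change the determinant.
  have h1 : (1 + P * G * N) * (P * G * P + N) = P * G + N := by
    have e1 : P * G * N * (P * G * P) = 0 := by
      rw [show P * G * N * (P * G * P) = P * G * (N * P) * (G * P) by
        simp only [Matrix.mul_assoc], hNP]; simp
    have e2 : P * G * N * N = P * G * N := by rw [Matrix.mul_assoc, hNN]
    rw [add_mul, one_mul, mul_add, e1, e2, zero_add]
    have : P * G * P + P * G * N = P * G := by
      rw [← mul_add, hP, sub_add_cancel, mul_one]
    rw [add_right_comm, this]
  have h2 : (1 + P * G * N).det = 1 := by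
    rw [det_one_add_mul_comm, ← Matrix.mul_assoc, hNP]; simp
  have h3 : (P * G * P + N).det = (P * G + N).det := by
    have := congrArg det h1
    rwa [det_mul, h2, one_mul] at this
  have h4 : P * G + N = (1 + N * (G' - 1)) * G := by
    rw [add_mul, Matrix.mul_assoc N, sub_mul G' 1 G, hG, hP, sub_mul, mul_sub]
    simp only [one_mul, mul_one]
    abel
  rw [h3, h4, det_mul, mul_comm]
  congr 1
  have h5 : N * (G' - 1) = replicateCol Unit v * replicateRow Unit (v ᵥ* (G' - 1)) := by
    rw [hNv, vecMulVec_mul, vecMulVec_eq Unit]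
  rw [h5, det_one_add_replicateCol_mul_replicateRow, vecMul_sub, vecMul_one, sub_dotProduct, hv,
    ← dotProduct_mulVec]
  ring

end HyperbolicChart

/-! ### The area formula -/

section AreaFormula

open Set Filter Topology
open scoped ENNReal NNReal

/-- If distances of values of `f` on `A` are at most `K` times those of `g`, then `f(A)` is a
`K`-Lipschitz image of `g(A)`. -/
theorem euclideanHausdorffMeasure_image_le {α X Y : Type*} [MetricSpace X] [MeasurableSpace X]
    [BorelSpace X] [MetricSpace Y] [MeasurableSpace Y] [BorelSpace Y] (d : ℕ) {f : α → X} {g : α → Y}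
    {K : ℝ≥0} {A : Set α} (h : ∀ x ∈ A, ∀ y ∈ A, dist (f x) (f y) ≤ K * dist (g x) (g y)) :
    μHE[d] (f '' A) ≤ (K : ℝ≥0∞) ^ d * μHE[d] (g '' A) := by
  rcases A.eq_empty_or_nonempty with rfl | ⟨a, ha⟩
  · simp
  have : Nonempty α := ⟨a⟩
  set s := Function.invFunOn g A
  have hs : ∀ x ∈ A, s (g x) ∈ A ∧ g (s (g x)) = g x := fun x hx =>
    ⟨Function.invFunOn_mem ⟨x, hx, rfl⟩, Function.invFunOn_eq ⟨x, hx, rfl⟩⟩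
  have himg : f '' A = (f ∘ s) '' (g '' A) := by
    rw [image_image]
    refine image_congr fun x hx => ?_
    have := h x hx _ (hs x hx).1
    rw [(hs x hx).2, dist_self, mul_zero] at this
    exact dist_le_zero.1 this
  have hL : LipschitzOnWith K (f ∘ s) (g '' A) := by
    refine LipschitzOnWith.of_dist_le_mul ?_
    rintro _ ⟨x, hx, rfl⟩ _ ⟨y, hy, rfl⟩
    have := h _ (hs x hx).1 _ (hs y hy).1
    rwa [(hs x hx).2, (hs y hy).2] at this
  rw [himg, Measure.euclideanHausdorffMeasure_def, Measure.euclideanHausdorffMeasure_def,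
    Measure.smul_apply, Measure.smul_apply, Measure.nnreal_smul_coe_apply, Measure.nnreal_smul_coe_apply,
    mul_left_comm]
  gcongr
  simpa using hL.hausdorffMeasure_image_le (d := d) (Nat.cast_nonneg d)

/-- In a second countable space, inequalities between measures are local. -/
theorem measure_le_of_locally_le {X : Type*} [TopologicalSpace X] [SecondCountableTopology X]
    [MeasurableSpace X] [OpensMeasurableSpace X] {μ ν : Measure X}
    (h : ∀ x, ∃ U ∈ 𝓝 x, ∀ A ⊆ U, MeasurableSet A → μ A ≤ ν A) : μ ≤ ν := by
  choose U hU hle using h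
  have hU' : ∀ x, interior (U x) ∈ 𝓝 x := fun x => interior_mem_nhds.2 (hU x)
  obtain ⟨t, ht, htU⟩ := TopologicalSpace.countable_cover_nhds hU'
  rcases isEmpty_or_nonempty X with hX | hX
  · rw [Measure.eq_zero_of_isEmpty μ]; exact Measure.zero_le ν
  have htne : t.Nonempty := by
    rw [nonempty_iff_ne_empty]
    rintro rfl
    simpa using htU.ge (mem_univ hX.some)
  obtain ⟨f, rfl⟩ := ht.exists_eq_range htne
  set W : ℕ → Set X := disjointed fun i => interior (U (f i))
  have hW : ∀ i, MeasurableSet (W i) := fun i =>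
    MeasurableSet.disjointed (fun i => isOpen_interior.measurableSet) i
  have hcov : ⋃ i, W i = univ := by
    rw [iUnion_disjointed, ← htU, biUnion_range]
  refine Measure.le_iff.2 fun A hA => ?_
  have hdis : Pairwise (Function.onFun Disjoint fun i => A ∩ W i) := fun i j hij =>
    (disjoint_disjointed _ hij).mono inter_subset_right inter_subset_right
  have hdec : A = ⋃ i, A ∩ W i := by rw [← inter_iUnion, hcov, inter_univ]
  rw [hdec, measure_iUnion hdis fun i => hA.inter (hW i),
    measure_iUnion hdis fun i => hA.inter (hW i)]
  exact ENNReal.tsum_le_tsum fun i => hle (f i) _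
    (inter_subset_right.trans ((disjointed_subset _ i).trans interior_subset)) (hA.inter (hW i))

variable {d : ℕ} {W : Type*} [NormedAddCommGroup W] [InnerProductSpace ℝ W]

/-- Near a point, an immersion is as close to bi-Lipschitz equivalent to its differential as
desired. -/
theorem exists_nhds_dist_le_mul {F : E d → W} {L : E d →L[ℝ] W} {y₀ : E d}
    (hF : HasStrictFDerivAt F L y₀) (hL : Function.Injective L) {c : ℝ≥0} (hc : 1 < c) :
    ∃ U ∈ 𝓝 y₀, ∀ x ∈ U, ∀ y ∈ U, dist (F x) (F y) ≤ c * dist (L x) (L y) ∧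
      dist (L x) (L y) ≤ c * dist (F x) (F y) := by
  obtain ⟨K, hK0, hK⟩ := (L : E d →ₗ[ℝ] W).exists_antilipschitzWith (LinearMap.ker_eq_bot.2 hL)
  have hc' : (1 : ℝ) < c := by exact_mod_cast hc
  set θ : ℝ := 1 - (c : ℝ)⁻¹ with hθ
  have hθ0 : 0 < θ := by rw [hθ, sub_pos]; exact inv_lt_one_of_one_lt₀ hc'
  have hK0' : (0 : ℝ) < K := by exact_mod_cast hK0
  have hη : 0 < θ / K := by positivity
  have hbound := (hasStrictFDerivAt_iff_isLittleO.1 hF).def hη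
  rw [nhds_prod_eq] at hbound
  obtain ⟨U, hU, hUU⟩ := mem_prod_self_iff.1 hbound
  refine ⟨U, hU, fun x hx y hy => ?_⟩
  have h1 : ‖F x - F y - L (x - y)‖ ≤ θ / K * ‖x - y‖ := hUU (mk_mem_prod hx hy)
  have h2 : ‖x - y‖ ≤ K * dist (L x) (L y) := by
    have := hK.le_mul_dist x y
    rwa [dist_eq_norm] at this
  have h3 : ‖F x - F y - L (x - y)‖ ≤ θ * dist (L x) (L y) := by
    refine h1.trans ?_
    calc θ / K * ‖x - y‖ ≤ θ / K * (K * dist (L x) (L y)) := by gcongr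
      _ = θ * dist (L x) (L y) := by field_simp
  rw [map_sub] at h3
  have h4 : dist (F x) (F y) ≤ (1 + θ) * dist (L x) (L y) := by
    simp only [dist_eq_norm] at *
    have := norm_add_le (F x - F y - (L x - L y)) (L x - L y)
    rw [sub_add_cancel] at this
    linarith
  have h5 : (1 - θ) * dist (L x) (L y) ≤ dist (F x) (F y) := by
    rw [dist_eq_norm, dist_eq_norm] at *
    have := norm_sub_norm_le (L x - L y) (F x - F y)
    rw [norm_sub_rev (L x - L y)] at this
    linarith
  have hcpos : (0 : ℝ) < c := by linarith
  have hcc : (c : ℝ) * (1 - θ) = 1 := by rw [hθ]; field_simp; ring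
  constructor
  · refine h4.trans ?_
    gcongr
    have : (c : ℝ)⁻¹ ≤ 1 := inv_le_one_of_one_le₀ hc'.le
    have : (c : ℝ)⁻¹ * c = 1 := inv_mul_cancel₀ hcpos.ne'
    nlinarith
  · calc dist (L x) (L y) = c * ((1 - θ) * dist (L x) (L y)) := by rw [← mul_assoc, hcc, one_mul]
      _ ≤ c * dist (F x) (F y) := by gcongr

variable [MeasurableSpace W] [BorelSpace W]

/-- **Area formula** for an injective immersion `F` of `ℝᵈ`: the `d`-dimensional Hausdorff measure
on the image is the image of the Jacobian density. -/
theorem map_withDensity_normDet {F : E d → W} {F' : E d → E d →L[ℝ] W}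
    (hF : ∀ y, HasStrictFDerivAt F (F' y) y) (hinj : ∀ y, Function.Injective (F' y))
    (hemb : MeasurableEmbedding F) {J : E d → ℝ} (hJ : Continuous J) (hJpos : ∀ y, 0 < J y)
    (hJF : ∀ y, (F' y : E d →ₗ[ℝ] W).normDet = J y) :
    ((volume : Measure (E d)).withDensity fun y => ENNReal.ofReal (J y)).map F =
      (μHE[d] : Measure W).restrict (range F) := by
  set ν := (volume : Measure (E d)).withDensity fun y => ENNReal.ofReal (J y) with hν
  set m := (μHE[d] : Measure W).comap F with hm
  have hlin : ∀ (y : E d) (A : Set (E d)),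
      (μHE[d] : Measure W) (F' y '' A) = ENNReal.ofReal (J y) * volume A := by
    intro y A
    have := (F' y : E d →ₗ[ℝ] W).euclideanHausdorffMeasure_image_eq_normDet_mul_volume A
    rw [finrank_euclideanSpace_fin, hJF] at this
    exact this
  -- Locally `F` is almost its differential, whose Jacobian is known; the error tends to zero with
  -- `c → 1`.
  have key : ∀ c : ℝ≥0, 1 < c → ∀ y₀ : E d, ∃ U ∈ 𝓝 y₀, ∀ A ⊆ U, MeasurableSet A →
      m A ≤ (((c : ℝ≥0∞) ^ (d + 1)) • ν) A ∧ ν A ≤ (((c : ℝ≥0∞) ^ (d + 1)) • m) A := by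
    intro c hc y₀
    obtain ⟨U, hU, hUb⟩ := exists_nhds_dist_le_mul (hF y₀) (hinj y₀) hc
    have hc' : (1 : ℝ) < c := by exact_mod_cast hc
    have hJ1 : ∀ᶠ y in 𝓝 y₀, J y < c * J y₀ :=
      hJ.continuousAt.eventually_lt_const (by nlinarith [hJpos y₀])
    have hJ2 : ∀ᶠ y in 𝓝 y₀, J y₀ < c * J y :=
      (hJ.const_mul (c : ℝ)).continuousAt.eventually_const_lt (by nlinarith [hJpos y₀])
    refine ⟨U ∩ {y | J y < c * J y₀ ∧ J y₀ < c * J y}, inter_mem hU (hJ1.and hJ2), ?_⟩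
    intro A hA hAm
    have hνA : ν A = ∫⁻ y in A, ENNReal.ofReal (J y) := withDensity_apply _ hAm
    have hmA : m A = (μHE[d] : Measure W) (F '' A) := hemb.comap_apply _ _
    have e1 : (μHE[d] : Measure W) (F '' A) ≤ (c : ℝ≥0∞) ^ d * (μHE[d] : Measure W) (F' y₀ '' A) :=
      euclideanHausdorffMeasure_image_le d fun x hx y hy => (hUb x (hA hx).1 y (hA hy).1).1
    have e2 : (μHE[d] : Measure W) (F' y₀ '' A) ≤ (c : ℝ≥0∞) ^ d * (μHE[d] : Measure W) (F '' A) :=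
      euclideanHausdorffMeasure_image_le d fun x hx y hy => (hUb x (hA hx).1 y (hA hy).1).2
    have hofc : ∀ r : ℝ, (c : ℝ≥0∞) * ENNReal.ofReal r = ENNReal.ofReal (c * r) := fun r => by
      rw [ENNReal.ofReal_mul (by positivity), ENNReal.ofReal_coe_nnreal]
    have e3 : ENNReal.ofReal (J y₀) * volume A ≤ c * ν A := by
      rw [hνA, ← setLIntegral_const, ← lintegral_const_mul' _ _ ENNReal.coe_ne_top]
      refine setLIntegral_mono' hAm fun y hy => ?_
      rw [hofc]
      exact ENNReal.ofReal_le_ofReal (hA hy).2.2.le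
    have e4 : ν A ≤ c * (ENNReal.ofReal (J y₀) * volume A) := by
      rw [hνA, ← setLIntegral_const, ← lintegral_const_mul' _ _ ENNReal.coe_ne_top]
      refine setLIntegral_mono' hAm fun y hy => ?_
      rw [hofc]
      exact ENNReal.ofReal_le_ofReal (hA hy).2.1.le
    rw [Measure.smul_apply, Measure.smul_apply, smul_eq_mul, smul_eq_mul, pow_succ, mul_assoc,
      mul_assoc, hmA]
    rw [hlin] at e1 e2
    refine ⟨e1.trans (by gcongr), e4.trans ?_⟩
    exact (mul_le_mul' le_rfl e2).trans (le_of_eq (by ring))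
  have hlim : ∀ a b : ℝ≥0∞, (∀ c : ℝ≥0, 1 < c → a ≤ (c : ℝ≥0∞) ^ (d + 1) * b) → a ≤ b := by
    intro a b hab
    have ht : Tendsto (fun c : ℝ≥0 => (c : ℝ≥0∞) ^ (d + 1) * b) (𝓝[>] 1) (𝓝 (1 * b)) := by
      refine ENNReal.Tendsto.mul_const ?_ (Or.inl one_ne_zero)
      have : Continuous fun c : ℝ≥0 => (c : ℝ≥0∞) ^ (d + 1) := by fun_prop
      simpa using (this.tendsto 1).mono_left nhdsWithin_le_nhds
    rw [one_mul] at ht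
    exact ge_of_tendsto ht (eventually_mem_nhdsWithin.mono fun c hc => hab c hc)
  have hmν : m = ν := by
    refine le_antisymm (Measure.le_iff.2 fun A _ => hlim _ _ fun c hc => ?_)
      (Measure.le_iff.2 fun A _ => hlim _ _ fun c hc => ?_)
    · refine (measure_le_of_locally_le (ν := ((c : ℝ≥0∞) ^ (d + 1)) • ν) fun y => ?_) A
      obtain ⟨U, hU, h⟩ := key c hc y
      exact ⟨U, hU, fun A hA hAm => (h A hA hAm).1⟩
    · refine (measure_le_of_locally_le (ν := ((c : ℝ≥0∞) ^ (d + 1)) • m) fun y => ?_) A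
      obtain ⟨U, hU, h⟩ := key c hc y
      exact ⟨U, hU, fun A hA hAm => (h A hA hAm).2⟩
  rw [← hmν, hm, hemb.map_comap]

end AreaFormula

/-! ### Graphs over coordinate hyperplanes -/

section Graphs

open Set Filter Topology
open scoped ENNReal NNReal

variable {d : ℕ}

/-- The point of `ℝᵈ⁺¹` with `i`-th coordinate `t` and the remaining coordinates `y`. -/
def insCoord (i : Fin (d + 1)) (t : ℝ) (y : E d) : E (d + 1) :=
  WithLp.toLp 2 (i.insertNth (α := fun _ => ℝ) t y)

/-- Forgetting the `i`-th coordinate. -/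
def dropCoord (i : Fin (d + 1)) : E (d + 1) →L[ℝ] E d :=
  LinearMap.toContinuousLinearMap
    { toFun := fun x => WithLp.toLp 2 fun j => x (i.succAbove j)
      map_add' := fun _ _ => rfl
      map_smul' := fun _ _ => rfl }

theorem dropCoord_apply (i : Fin (d + 1)) (x : E (d + 1)) (j : Fin d) :
    dropCoord i x j = x (i.succAbove j) := rfl

/-- The coordinate hyperplane inclusion `y ↦ insCoord i 0 y`. -/
def liftCoord (i : Fin (d + 1)) : E d →L[ℝ] E (d + 1) :=
  LinearMap.toContinuousLinearMap
    { toFun := fun y => insCoord i 0 y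
      map_add' := fun x y => by
        ext j
        refine Fin.succAboveCases i ?_ (fun j => ?_) j <;> simp [insCoord]
      map_smul' := fun c y => by
        ext j
        refine Fin.succAboveCases i ?_ (fun j => ?_) j <;> simp [insCoord] }

@[simp] theorem insCoord_same (i : Fin (d + 1)) (t : ℝ) (y : E d) : insCoord i t y i = t := by
  simp [insCoord]

@[simp] theorem insCoord_succAbove (i : Fin (d + 1)) (t : ℝ) (y : E d) (j : Fin d) :
    insCoord i t y (i.succAbove j) = y j := by simp [insCoord]

@[simp] theorem dropCoord_insCoord (i : Fin (d + 1)) (t : ℝ) (y : E d) :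
    dropCoord i (insCoord i t y) = y := by
  ext j; simp [dropCoord_apply]

theorem insCoord_dropCoord (i : Fin (d + 1)) (x : E (d + 1)) :
    insCoord i (x i) (dropCoord i x) = x := by
  ext j
  refine Fin.succAboveCases i ?_ (fun j => ?_) j <;> simp [dropCoord_apply]

theorem insCoord_eq (i : Fin (d + 1)) (t : ℝ) (y : E d) :
    insCoord i t y = t • EuclideanSpace.single i 1 + liftCoord i y := by
  ext j
  refine Fin.succAboveCases i ?_ (fun j => ?_) j <;> simp [liftCoord]

@[simp] theorem liftCoord_single (i : Fin (d + 1)) (j : Fin d) :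
    liftCoord i (EuclideanSpace.single j 1) = EuclideanSpace.single (i.succAbove j) 1 := by
  ext l
  refine Fin.succAboveCases i ?_ (fun l => ?_) l
  · simp [liftCoord, Fin.ne_succAbove]
  · simp [liftCoord]

@[simp] theorem dropCoord_single_same (i : Fin (d + 1)) :
    dropCoord i (EuclideanSpace.single i 1) = 0 := by
  ext l; simp [dropCoord_apply]

@[simp] theorem dropCoord_single_succAbove (i : Fin (d + 1)) (j : Fin d) :
    dropCoord i (EuclideanSpace.single (i.succAbove j) 1) = EuclideanSpace.single j 1 := by
  ext l; simp [dropCoord_apply]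

/-- The parametrization `y ↦ (y, φ(y))` of the graph of `φ`. -/
def graphMap (i : Fin (d + 1)) (φ : E d → ℝ) (y : E d) : E (d + 1) := insCoord i (φ y) y

/-- The area density `√(1 + |∇φ|²)` of the graph of `φ`. -/
def graphJac (φ : E d → ℝ) (y : E d) : ℝ :=
  Real.sqrt (1 + ∑ j, (fderiv ℝ φ y (EuclideanSpace.single j 1)) ^ 2)

theorem graphJac_pos (φ : E d → ℝ) (y : E d) : 0 < graphJac φ y :=
  Real.sqrt_pos.2 (add_pos_of_pos_of_nonneg one_pos (Finset.sum_nonneg fun _ _ => sq_nonneg _))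

theorem continuous_graphMap (i : Fin (d + 1)) {φ : E d → ℝ} (hφ : Continuous φ) :
    Continuous (graphMap i φ) := by
  unfold graphMap
  simp_rw [insCoord_eq]
  fun_prop

theorem measurableEmbedding_graphMap (i : Fin (d + 1)) {φ : E d → ℝ} (hφ : Continuous φ) :
    MeasurableEmbedding (graphMap i φ) :=
  (Function.LeftInverse.isClosedEmbedding (f := dropCoord i) (fun y => dropCoord_insCoord i _ y)
    (dropCoord i).continuous (continuous_graphMap i hφ)).measurableEmbedding

/-- Area formula for the graph of `φ`. -/
theorem map_graphMap (i : Fin (d + 1)) {φ : E d → ℝ} (hφ : ContDiff ℝ 1 φ) :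
    ((volume : Measure (E d)).withDensity fun y => ENNReal.ofReal (graphJac φ y)).map
      (graphMap i φ) = (μHE[d] : Measure (E (d + 1))).restrict (range (graphMap i φ)) := by
  have hF : ∀ y, HasStrictFDerivAt (graphMap i φ)
      ((fderiv ℝ φ y).smulRight (EuclideanSpace.single i 1) + liftCoord i) y := by
    intro y
    have h1 := (hφ.contDiffAt.hasStrictFDerivAt one_ne_zero : HasStrictFDerivAt φ _ y)
    have h2 := (h1.smul_const (EuclideanSpace.single i (1 : ℝ))).add
      (liftCoord i).hasStrictFDerivAt
    unfold graphMap
    simp_rw [insCoord_eq]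
    exact h2
  refine map_withDensity_normDet hF (fun y => ?_) (measurableEmbedding_graphMap i hφ.continuous) ?_
    (graphJac_pos φ) fun y => ?_
  · intro a b hab
    have := congrArg (dropCoord i) hab
    simpa [← insCoord_eq] using this
  · unfold graphJac
    have := hφ.continuous_fderiv one_ne_zero
    fun_prop
  · rw [graphJac, eq_comm, Real.sqrt_eq_iff_eq_sq (by positivity)
      (LinearMap.normDet_nonneg _)]
    set a : Fin d → ℝ := fun j => fderiv ℝ φ y (EuclideanSpace.single j 1) with ha
    have h := LinearMap.normDet_sq_eq_det_gram (𝕜 := ℝ) (((fderiv ℝ φ y).smulRight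
      (EuclideanSpace.single i 1) + liftCoord i : E d →L[ℝ] E (d + 1)) : E d →ₗ[ℝ] E (d + 1))
      (EuclideanSpace.basisFun (Fin d) ℝ)
    refine Eq.trans ?_ h.symm
    have hg : Matrix.gram ℝ (fun j => (((fderiv ℝ φ y).smulRight
      (EuclideanSpace.single i 1) + liftCoord i : E d →L[ℝ] E (d + 1)) : E d →ₗ[ℝ] E (d + 1))
      (EuclideanSpace.basisFun (Fin d) ℝ j)) =
      1 + Matrix.replicateCol Unit a * Matrix.replicateRow Unit a := by
      ext j l
      rw [Matrix.gram_apply]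
      simp [Matrix.mul_apply, inner_add_left, inner_add_right, inner_smul_left, inner_smul_right,
        EuclideanSpace.inner_single_right, ha, Matrix.one_apply, Fin.ne_succAbove]
      rw [add_comm, mul_comm, if_congr (eq_comm (a := l)) rfl rfl]
    rw [hg, Matrix.det_one_add_replicateCol_mul_replicateRow, dotProduct]
    simp_rw [sq, ha]

theorem integral_graph (i : Fin (d + 1)) {φ : E d → ℝ} (hφ : ContDiff ℝ 1 φ) (g : E (d + 1) → ℝ) :
    ∫ x in range (graphMap i φ), g x ∂(μHE[d] : Measure (E (d + 1))) =
      ∫ y, graphJac φ y * g (graphMap i φ y) := by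
  have hJ : Continuous (graphJac φ) := by
    unfold graphJac
    have := hφ.continuous_fderiv one_ne_zero
    fun_prop
  rw [← map_graphMap i hφ, (measurableEmbedding_graphMap i hφ.continuous).integral_map,
    integral_withDensity_eq_integral_toReal_smul (by fun_prop) (by simp)]
  simp [ENNReal.toReal_ofReal (graphJac_pos φ _).le]

theorem integrableOn_graph (i : Fin (d + 1)) {φ : E d → ℝ} (hφ : ContDiff ℝ 1 φ)
    {g : E (d + 1) → ℝ} (hg : Integrable fun y => graphJac φ y * g (graphMap i φ y)) :
    IntegrableOn g (range (graphMap i φ)) (μHE[d] : Measure (E (d + 1))) := by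
  have hJ : Continuous (graphJac φ) := by
    unfold graphJac
    have := hφ.continuous_fderiv one_ne_zero
    fun_prop
  rw [IntegrableOn, ← map_graphMap i hφ,
    (measurableEmbedding_graphMap i hφ.continuous).integrable_map_iff,
    integrable_withDensity_iff_integrable_smul' (by fun_prop) (by simp)]
  simpa [ENNReal.toReal_ofReal (graphJac_pos φ _).le] using hg

end Graphs

/-! ### The divergence theorem below or above a graph -/

section GraphDivergence

open Set Filter Topology
open scoped ENNReal NNReal
variable {d : ℕ}

/-- Euclidean divergence of the vector field with components `X j`. -/
def euclDiv {n : ℕ} (X : Fin n → E n → ℝ) (x : E n) : ℝ :=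
  ∑ j, fderiv ℝ (X j) x (EuclideanSpace.single j 1)

/-- The volume preserving shear which takes `{z_i < 0}` to the set below (`ε = 1`) or above
(`ε = -1`) the graph of `φ`. Its source carries the sup norm, as boxes live there. -/
def shear (i : Fin (d + 1)) (φ : E d → ℝ) (ε : ℝ) (z : Fin (d + 1) → ℝ) : E (d + 1) :=
  insCoord i (φ (dropCoord i (WithLp.toLp 2 z)) + ε * z i) (dropCoord i (WithLp.toLp 2 z))

@[simp] theorem shear_same (i : Fin (d + 1)) (φ : E d → ℝ) (ε : ℝ) (z : Fin (d + 1) → ℝ) :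
    shear i φ ε z i = φ (dropCoord i (WithLp.toLp 2 z)) + ε * z i := insCoord_same _ _ _

@[simp] theorem dropCoord_shear (i : Fin (d + 1)) (φ : E d → ℝ) (ε : ℝ) (z : Fin (d + 1) → ℝ) :
    dropCoord i (shear i φ ε z) = dropCoord i (WithLp.toLp 2 z) := dropCoord_insCoord _ _ _

theorem continuous_shear (i : Fin (d + 1)) {φ : E d → ℝ} (hφ : Continuous φ) (ε : ℝ) :
    Continuous (shear i φ ε) := by
  unfold shear
  simp_rw [insCoord_eq]
  fun_prop

theorem measurableEmbedding_shear (i : Fin (d + 1)) {φ : E d → ℝ} (hφ : Continuous φ) {ε : ℝ}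
    (hε : ε * ε = 1) : MeasurableEmbedding (shear i φ ε) := by
  refine (Function.LeftInverse.isClosedEmbedding
    (f := fun x => WithLp.ofLp (insCoord i (ε * (x i - φ (dropCoord i x))) (dropCoord i x)))
    (fun z => ?_) ?_ (continuous_shear i hφ ε)).measurableEmbedding
  · simp only [shear_same, dropCoord_shear]
    rw [add_sub_cancel_left, ← mul_assoc, hε, one_mul]
    exact congrArg WithLp.ofLp (insCoord_dropCoord i (WithLp.toLp 2 z))
  · simp_rw [insCoord_eq]
    fun_prop

theorem measurePreserving_shear (i : Fin (d + 1)) {φ : E d → ℝ} (hφ : Continuous φ) {ε : ℝ}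
    (hε : ε = 1 ∨ ε = -1) : MeasurePreserving (shear i φ ε) volume volume := by
  have h0 := volume_preserving_piFinSuccAbove (fun _ : Fin (d + 1) => ℝ) i
  have hline : ∀ y : Fin d → ℝ,
      MeasurePreserving (fun t : ℝ => φ (WithLp.toLp 2 y) + ε * t) volume volume := by
    intro y
    refine (measurePreserving_add_left (volume : Measure ℝ) (φ (WithLp.toLp 2 y))).comp
      (g := fun t : ℝ => φ (WithLp.toLp 2 y) + t) (f := fun t : ℝ => ε * t) ?_
    rcases hε with rfl | rfl
    · simp only [one_mul]
      exact MeasurePreserving.id volume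
    · simpa only [neg_one_mul] using Measure.measurePreserving_neg (volume : Measure ℝ)
  have h1 : MeasurePreserving (fun p : (Fin d → ℝ) × ℝ => (p.1, φ (WithLp.toLp 2 p.1) + ε * p.2))
      (volume.prod volume) (volume.prod volume) :=
    (MeasurePreserving.id volume).skew_product (g := fun y t => φ (WithLp.toLp 2 y) + ε * t)
      (by
        have : Continuous fun p : (Fin d → ℝ) × ℝ => φ (WithLp.toLp 2 p.1) + ε * p.2 := by fun_prop
        exact this.measurable) (Eventually.of_forall fun y => (hline y).map_eq)
  have hsw := Measure.measurePreserving_swap (μ := (volume : Measure ℝ))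
    (ν := (volume : Measure (Fin d → ℝ)))
  have hsw' := Measure.measurePreserving_swap (μ := (volume : Measure (Fin d → ℝ)))
    (ν := (volume : Measure ℝ))
  have h2 := (PiLp.volume_preserving_toLp (Fin (d + 1))).comp
    ((h0.symm _).comp (hsw'.comp (h1.comp (hsw.comp h0))))
  convert! h2 using 1

/-- The vector field `Y` in the coordinates of `shear`. It has the same divergence. -/
def shearField (i : Fin (d + 1)) (φ : E d → ℝ) (ε : ℝ) (Y : Fin (d + 1) → E (d + 1) → ℝ) :
    Fin (d + 1) → (Fin (d + 1) → ℝ) → ℝ :=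
  i.insertNth (α := fun _ => (Fin (d + 1) → ℝ) → ℝ)
    (fun z => ε * (Y i (shear i φ ε z) - ∑ j, fderiv ℝ φ (dropCoord i (WithLp.toLp 2 z))
      (EuclideanSpace.single j 1) * Y (i.succAbove j) (shear i φ ε z)))
    fun j z => Y (i.succAbove j) (shear i φ ε z)

theorem shearField_same (i : Fin (d + 1)) (φ : E d → ℝ) (ε : ℝ) (Y : Fin (d + 1) → E (d + 1) → ℝ) :
    shearField i φ ε Y i = fun z => ε * (Y i (shear i φ ε z) -
      ∑ j, fderiv ℝ φ (dropCoord i (WithLp.toLp 2 z)) (EuclideanSpace.single j 1) *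
        Y (i.succAbove j) (shear i φ ε z)) := by
  simp [shearField]

theorem shearField_succAbove (i : Fin (d + 1)) (φ : E d → ℝ) (ε : ℝ)
    (Y : Fin (d + 1) → E (d + 1) → ℝ) (j : Fin d) :
    shearField i φ ε Y (i.succAbove j) = fun z => Y (i.succAbove j) (shear i φ ε z) := by
  simp [shearField]

/-- The identity of `ℝᵈ⁺¹`, from the sup norm to the Euclidean norm. -/
def toEucl (m : ℕ) : (Fin m → ℝ) →L[ℝ] E m :=
  ((PiLp.continuousLinearEquiv 2 ℝ (fun _ : Fin m => ℝ)).symm : (Fin m → ℝ) →L[ℝ] E m)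

theorem toEucl_single {m : ℕ} (j : Fin m) :
    toEucl m (Pi.single j 1) = EuclideanSpace.single j 1 := rfl

theorem hasFDerivAt_shear (i : Fin (d + 1)) {φ : E d → ℝ} (hφ : Differentiable ℝ φ) (ε : ℝ)
    (z : Fin (d + 1) → ℝ) : HasFDerivAt (shear i φ ε)
      (((fderiv ℝ φ (dropCoord i (WithLp.toLp 2 z))).comp ((dropCoord i).comp (toEucl (d + 1))) +
        ε • ContinuousLinearMap.proj i).smulRight (EuclideanSpace.single i 1) +
        (liftCoord i).comp ((dropCoord i).comp (toEucl (d + 1)))) z := by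
  have h1 : HasFDerivAt (fun z : Fin (d + 1) → ℝ => dropCoord i (WithLp.toLp 2 z))
      ((dropCoord i).comp (toEucl (d + 1))) z := ((dropCoord i).comp (toEucl (d + 1))).hasFDerivAt
  have h2 := (((hφ _).hasFDerivAt.comp z h1).add
    ((hasFDerivAt_apply i z).const_mul ε)).smul_const (EuclideanSpace.single i (1 : ℝ))
  have h3 := h2.add ((liftCoord i).hasFDerivAt.comp z h1)
  unfold shear
  simp_rw [insCoord_eq]
  exact h3

theorem sum_fderiv_shearField (i : Fin (d + 1)) {φ : E d → ℝ} (hφ : ContDiff ℝ 2 φ) {ε : ℝ}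
    (hε : ε * ε = 1) (Y : Fin (d + 1) → E (d + 1) → ℝ) (z : Fin (d + 1) → ℝ)
    (hY : ∀ j, DifferentiableAt ℝ (Y j) (shear i φ ε z)) :
    (∀ j, DifferentiableAt ℝ (shearField i φ ε Y j) z) ∧
    ∑ j, fderiv ℝ (shearField i φ ε Y j) z (Pi.single j 1) = euclDiv Y (shear i φ ε z) := by
  have hs := hasFDerivAt_shear i (hφ.differentiable two_ne_zero) ε z
  have hcomp : ∀ j, HasFDerivAt (fun z => Y j (shear i φ ε z)) _ z := fun j =>
    (hY j).hasFDerivAt.comp z hs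
  have h1 : HasFDerivAt (fun z : Fin (d + 1) → ℝ => dropCoord i (WithLp.toLp 2 z))
      ((dropCoord i).comp (toEucl (d + 1))) z := ((dropCoord i).comp (toEucl (d + 1))).hasFDerivAt
  have hg : ∀ j : Fin d, DifferentiableAt ℝ
      (fun y => fderiv ℝ φ y (EuclideanSpace.single j 1)) (dropCoord i (WithLp.toLp 2 z)) := by
    intro j
    have : Differentiable ℝ (fderiv ℝ φ) :=
      (hφ.fderiv_right (m := 1) (by norm_num)).differentiable one_ne_zero
    exact (this _).clm_apply (differentiableAt_const _)
  have hgc : ∀ j : Fin d, HasFDerivAt (fun z : Fin (d + 1) → ℝ => fderiv ℝ φ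
      (dropCoord i (WithLp.toLp 2 z)) (EuclideanSpace.single j 1))
      ((fderiv ℝ (fun y => fderiv ℝ φ y (EuclideanSpace.single j 1))
        (dropCoord i (WithLp.toLp 2 z))).comp ((dropCoord i).comp (toEucl (d + 1)))) z := fun j =>
    HasFDerivAt.comp (g := fun y => fderiv ℝ φ y (EuclideanSpace.single j 1)) z
      (hg j).hasFDerivAt h1
  have hi := ((hcomp i).sub (HasFDerivAt.fun_sum (u := Finset.univ) fun j _ =>
    (hgc j).mul (hcomp (i.succAbove j)))).const_mul ε
  have hsi := (shearField_same i φ ε Y).symm ▸ hi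
  have hsj : ∀ j, _ := fun j => (shearField_succAbove i φ ε Y j).symm ▸ hcomp (i.succAbove j)
  refine ⟨fun j => ?_, ?_⟩
  · refine Fin.succAboveCases i ?_ (fun j => ?_) j
    exacts [hsi.differentiableAt, (hsj j).differentiableAt]
  · rw [Fin.sum_univ_succAbove _ i, hsi.fderiv, euclDiv, Fin.sum_univ_succAbove _ i]
    simp_rw [(hsj _).fderiv]
    simp [toEucl_single]
    have he : ∀ p q : Fin d → ℝ, ε * ∑ x, p x * (ε * q x) = ∑ x, p x * q x := fun p q => by
      rw [Finset.mul_sum]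
      exact Finset.sum_congr rfl fun x _ => by linear_combination (p x * q x) * hε
    rw [Finset.sum_add_distrib, mul_sub, he, ← mul_assoc, hε]
    ring

theorem norm_dropCoord_le (i : Fin (d + 1)) (x : E (d + 1)) : ‖dropCoord i x‖ ≤ ‖x‖ := by
  rw [EuclideanSpace.norm_eq, EuclideanSpace.norm_eq]
  refine Real.sqrt_le_sqrt ?_
  rw [Fin.sum_univ_succAbove (fun j => ‖x j‖ ^ 2) i]
  exact le_add_of_nonneg_left (sq_nonneg _)

/-- Outside a large box, the shear takes values outside the ball of radius `R`. -/
theorem lt_norm_shear {i : Fin (d + 1)} {φ : E d → ℝ} {ε R B M : ℝ} (hε : ε = 1 ∨ ε = -1)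
    (hB0 : 0 ≤ B) (hB : ∀ y, ‖y‖ ≤ R → |φ y| ≤ B) (hM : R + B < M) {z : Fin (d + 1) → ℝ}
    (hz : ∃ j, M ≤ |z j|) : R < ‖shear i φ ε z‖ := by
  by_contra! hle
  obtain ⟨j, hj⟩ := hz
  have hcoord : ∀ k, |shear i φ ε z k| ≤ R := fun k => (PiLp.norm_apply_le _ k).trans hle
  revert hj
  refine Fin.succAboveCases i ?_ (fun j => ?_) j
  · intro hj
    have h1 := hB _ ((norm_dropCoord_le i _).trans hle)
    have h2 := hcoord i
    rw [dropCoord_shear] at h1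
    rw [shear_same] at h2
    have h3 : |ε * z i| = |z i| := by rcases hε with rfl | rfl <;> simp
    have h4 := abs_sub (φ (dropCoord i (WithLp.toLp 2 z)) + ε * z i) (φ (dropCoord i (WithLp.toLp 2 z)))
    rw [add_sub_cancel_left, h3] at h4
    linarith
  · intro hj
    have h2 := hcoord (i.succAbove j)
    simp only [shear, insCoord_succAbove, dropCoord_apply] at h2
    linarith

theorem euclDiv_eq_zero {n : ℕ} {X : Fin n → E n → ℝ} {x : E n} (h : ∀ j, X j =ᶠ[𝓝 x] 0) :
    euclDiv X x = 0 :=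
  Finset.sum_eq_zero fun j _ => by rw [(h j).fderiv_eq]; simp

/-- **Divergence theorem** on the set below (`ε = 1`) or above (`ε = -1`) the graph of a `C²`
function, for vector fields of bounded support which are continuous up to the graph and have an
integrable divergence. -/
theorem setIntegral_euclDiv_graph (i : Fin (d + 1)) {φ : E d → ℝ} (hφ : ContDiff ℝ 2 φ) {ε : ℝ}
    (hε : ε = 1 ∨ ε = -1) {Y : Fin (d + 1) → E (d + 1) → ℝ} {R : ℝ} (hR : 0 ≤ R)
    (hsupp : ∀ j x, R < ‖x‖ → Y j x = 0)
    (hc : ∀ j, ContinuousOn (Y j) {x | ε * (x i - φ (dropCoord i x)) ≤ 0})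
    (hd : ∀ j x, ε * (x i - φ (dropCoord i x)) < 0 → DifferentiableAt ℝ (Y j) x)
    (hi : IntegrableOn (euclDiv Y) {x | ε * (x i - φ (dropCoord i x)) < 0}) :
    ∫ x in {x | ε * (x i - φ (dropCoord i x)) < 0}, euclDiv Y x =
      ∫ y, ε * (Y i (graphMap i φ y) - ∑ j, fderiv ℝ φ y (EuclideanSpace.single j 1) *
        Y (i.succAbove j) (graphMap i φ y)) := by
  have hεε : ε * ε = 1 := by rcases hε with rfl | rfl <;> norm_num
  have hφc := hφ.continuous
  obtain ⟨B, hB0, hB⟩ : ∃ B, 0 ≤ B ∧ ∀ y, ‖y‖ ≤ R → |φ y| ≤ B := by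
    obtain ⟨B, hB⟩ := (isCompact_closedBall (0 : E d) R).exists_bound_of_continuousOn
      hφc.continuousOn
    exact ⟨|B|, abs_nonneg B, fun y hy => (hB y (by simpa using hy)).trans (le_abs_self B)⟩
  set M := R + B + 1 with hM
  have hM0 : 0 < M := by positivity
  have hfar : ∀ {z : Fin (d + 1) → ℝ}, (∃ j, M ≤ |z j|) → R < ‖shear i φ ε z‖ := fun hz =>
    lt_norm_shear hε hB0 hB (by linarith) hz
  have hYfar : ∀ (j : Fin (d + 1)) (z : Fin (d + 1) → ℝ), (∃ j, M ≤ |z j|) →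
      Y j (shear i φ ε z) = 0 := fun j z hz => hsupp j _ (hfar hz)
  have hdivfar : ∀ x, R < ‖x‖ → euclDiv Y x = 0 := fun x hx => euclDiv_eq_zero fun j => by
    filter_upwards [continuous_norm.continuousAt.eventually_const_lt hx] with y hy
    exact hsupp j y hy
  set Ω := {x : E (d + 1) | ε * (x i - φ (dropCoord i x)) < 0} with hΩ
  have hpre : shear i φ ε ⁻¹' Ω = {z | z i < 0} := by
    ext z
    simp only [hΩ, mem_preimage, mem_ofPred_eq, shear_same, dropCoord_shear, add_sub_cancel_left]
    rw [← mul_assoc, hεε, one_mul]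
  -- In the coordinates of the shear, integrate over the box `-M ≤ z_j ≤ M` (`j ≠ i`),
  -- `-M ≤ z_i ≤ 0`; the field vanishes on all its faces but `z_i = 0`.
  set a : Fin (d + 1) → ℝ := fun _ => -M with ha
  set b : Fin (d + 1) → ℝ := i.insertNth (α := fun _ => ℝ) 0 fun _ => M with hb
  have hbi : b i = 0 := by simp [hb]
  have hbj : ∀ j, b (i.succAbove j) = M := fun j => by simp [hb]
  have hab : a ≤ b := fun j => by
    refine Fin.succAboveCases i ?_ (fun j => ?_) j
    · rw [hbi]; simp only [ha]; linarith
    · rw [hbj]; simp only [ha]; linarith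
  set Q : Set (Fin (d + 1) → ℝ) := pi univ fun j => Ioo (a j) (b j) with hQ
  have hQi : ∀ z ∈ Q, z i < 0 := fun z hz => by simpa [hbi] using (hz i (mem_univ i)).2
  have hQmem : ∀ z : Fin (d + 1) → ℝ, z i < 0 → z ∉ Q → ∃ j, M ≤ |z j| := by
    intro z hz hzQ
    by_contra! hlt
    have hzb : ∀ j, z j < b j := fun j => ?_
    · exact hzQ fun j _ => ⟨(abs_lt.1 (hlt j)).1, hzb j⟩
    refine Fin.succAboveCases i ?_ (fun j => ?_) j
    · rwa [hbi]
    · rw [hbj]; exact (abs_lt.1 (hlt _)).2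
  have hQIcc : Q =ᵐ[volume] Icc a b := Measure.univ_pi_Ioo_ae_eq_Icc
  have hmp := measurePreserving_shear i hφc hε
  have hme := measurableEmbedding_shear i hφc hεε
  have hdz : ∀ z ∈ Q, ∀ j, DifferentiableAt ℝ (Y j) (shear i φ ε z) := fun z hz j =>
    hd j _ (by
      have : z ∈ shear i φ ε ⁻¹' Ω := by rw [hpre]; exact hQi z hz
      exact this)
  have hQm : MeasurableSet Q := MeasurableSet.univ_pi fun j => measurableSet_Ioo
  have hsum : ∀ z ∈ Q, ∑ j, fderiv ℝ (shearField i φ ε Y j) z (Pi.single j 1) =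
      euclDiv Y (shear i φ ε z) := fun z hz => (sum_fderiv_shearField i hφ hεε Y z (hdz z hz)).2
  have hlhs : ∫ x in Ω, euclDiv Y x =
      ∫ z in Icc a b, ∑ j, fderiv ℝ (shearField i φ ε Y j) z (Pi.single j 1) := by
    rw [← hmp.setIntegral_preimage_emb hme, hpre, ← setIntegral_congr_set hQIcc,
      setIntegral_congr_fun hQm hsum]
    refine setIntegral_eq_of_subset_of_forall_sdiff_eq_zero
      (measurableSet_lt (measurable_pi_apply i) measurable_const) hQi fun z hz => ?_
    exact hdivfar _ (hfar (hQmem z hz.1 hz.2))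
  have hint : IntegrableOn (fun z => ∑ j, fderiv ℝ (shearField i φ ε Y j) z (Pi.single j 1))
      (Icc a b) := by
    refine IntegrableOn.congr_set_ae ?_ hQIcc.symm
    refine IntegrableOn.congr_fun ?_ (fun z hz => (hsum z hz).symm) hQm
    have := (hmp.integrableOn_comp_preimage hme).2 hi
    rw [hpre] at this
    exact this.mono_set hQi
  have hcont : ∀ j, ContinuousOn (shearField i φ ε Y j) (Icc a b) := by
    have hmaps : MapsTo (shear i φ ε) (Icc a b) {x | ε * (x i - φ (dropCoord i x)) ≤ 0} := by
      intro z hz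
      have : z i ≤ 0 := by simpa [hbi] using hz.2 i
      simp only [mem_ofPred_eq, shear_same, dropCoord_shear, add_sub_cancel_left]
      rwa [← mul_assoc, hεε, one_mul]
    have h1 : ∀ j, ContinuousOn (fun z => Y j (shear i φ ε z)) (Icc a b) := fun j =>
      (hc j).comp (continuous_shear i hφc ε).continuousOn hmaps
    have h2 := hφ.continuous_fderiv two_ne_zero
    intro j
    refine Fin.succAboveCases i ?_ (fun j => ?_) j
    · rw [shearField_same]
      refine continuousOn_const.mul ((h1 i).sub (continuousOn_finsetSum _ fun j _ => ?_))
      exact ContinuousOn.mul (by fun_prop) (h1 _)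
    · rw [shearField_succAbove]
      exact h1 _
  have hmain := integral_divergence_of_hasFDerivAt_off_countable' a b hab (shearField i φ ε Y)
    (fun j z => fderiv ℝ (shearField i φ ε Y j) z) ∅ countable_empty hcont
    (fun z hz j => ((sum_fderiv_shearField i hφ hεε Y z (hdz z hz.1)).1 j).hasFDerivAt) hint
  rw [hlhs, hmain, Fin.sum_univ_succAbove _ i]
  have hfield0 : ∀ (j : Fin (d + 1)) (z : Fin (d + 1) → ℝ), (∃ j, M ≤ |z j|) →
      shearField i φ ε Y j z = 0 := by
    intro j z hz
    refine Fin.succAboveCases i ?_ (fun j => ?_) j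
    · rw [shearField_same]
      simp [hYfar _ z hz]
    · rw [shearField_succAbove]
      exact hYfar _ z hz
  have hz1 : ∀ (j : Fin (d + 1)) (t : ℝ) (w : Fin d → ℝ), M ≤ |t| →
      shearField i φ ε Y j (j.insertNth (α := fun _ => ℝ) t w) = 0 := fun j t w ht =>
    hfield0 j _ ⟨j, by simpa using ht⟩
  have hMM : M ≤ |-M| := by rw [abs_neg]; exact le_abs_self M
  have hrest : ∀ j : Fin d, ((∫ w in Icc (a ∘ (i.succAbove j).succAbove)
        (b ∘ (i.succAbove j).succAbove), shearField i φ ε Y (i.succAbove j)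
          ((i.succAbove j).insertNth (α := fun _ => ℝ) (b (i.succAbove j)) w)) -
      ∫ w in Icc (a ∘ (i.succAbove j).succAbove) (b ∘ (i.succAbove j).succAbove),
        shearField i φ ε Y (i.succAbove j)
          ((i.succAbove j).insertNth (α := fun _ => ℝ) (a (i.succAbove j)) w)) = 0 := by
    intro j
    simp_rw [hz1 _ (b (i.succAbove j)) _ (by rw [hbj]; exact le_abs_self M), hz1 _ (a _) _ hMM]
    simp
  rw [Finset.sum_eq_zero fun j _ => hrest j, add_zero]
  simp_rw [hz1 i (a i) _ hMM, integral_zero, sub_zero, hbi]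
  rw [setIntegral_eq_integral_of_forall_compl_eq_zero]
  · rw [← (PiLp.volume_preserving_toLp (Fin d)).integral_comp
      (MeasurableEquiv.toLp 2 (Fin d → ℝ)).measurableEmbedding]
    refine integral_congr_ae (Eventually.of_forall fun w => ?_)
    have hdrop : dropCoord i (WithLp.toLp 2 (i.insertNth (α := fun _ => ℝ) 0 w)) =
        WithLp.toLp 2 w := dropCoord_insCoord i 0 (WithLp.toLp 2 w)
    simp only [shearField_same, shear, graphMap, hdrop, Fin.insertNth_apply_same, mul_zero,
      add_zero]
  · intro w hw
    refine hfield0 _ _ ?_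
    by_contra! hlt
    refine hw ⟨fun j => ?_, fun j => ?_⟩
    · have := abs_lt.1 (hlt (i.succAbove j))
      simpa [ha] using this.1.le
    · have := abs_lt.1 (hlt (i.succAbove j))
      simpa [hb] using this.2.le

end GraphDivergence

/-! ### Boundary structure of `C²` domains -/

section Boundary

open Set Filter Topology
open scoped ENNReal NNReal

variable {n : ℕ} {Ω : Set (E n)} {x : E n} {ρ : E n → ℝ}

theorem gradient_coord (ρ : E n → ℝ) (x : E n) (j : Fin n) :
    gradient ρ x j = fderiv ℝ ρ x (EuclideanSpace.single j 1) := by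
  have h := InnerProductSpace.toDual_symm_apply (𝕜 := ℝ) (x := EuclideanSpace.single j (1 : ℝ))
    (y := fderiv ℝ ρ x)
  rw [← h]
  simp only [EuclideanSpace.inner_single_right, conj_trivial, one_mul]
  rfl

theorem inner_gradient (ρ : E n → ℝ) (x v : E n) : inner ℝ (gradient ρ x) v = fderiv ℝ ρ x v :=
  InnerProductSpace.toDual_symm_apply

theorem IsLocalDefining.tendsto_slope (h : IsLocalDefining Ω x ρ) (v : E n) :
    Tendsto (fun t : ℝ => t⁻¹ * ρ (x + t • v)) (𝓝[>] 0) (𝓝 (fderiv ℝ ρ x v)) := by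
  have hd : HasFDerivAt ρ (fderiv ℝ ρ x) x := (h.1.differentiableAt two_ne_zero).hasFDerivAt
  have hline : HasDerivAt (fun t : ℝ => x + t • v) v 0 := by
    simpa using ((hasDerivAt_id (0 : ℝ)).smul_const v).const_add x
  have h1 := (hd.comp_hasDerivAt_of_eq 0 hline (by simp)).tendsto_slope_zero_right
  simpa [h.2.2.1] using h1

/-- Directions along which a defining function decreases point into the domain. -/
theorem IsLocalDefining.eventually_mem (h : IsLocalDefining Ω x ρ) {v : E n}
    (hv : fderiv ℝ ρ x v < 0) : ∀ᶠ t in 𝓝[>] (0 : ℝ), x + t • v ∈ Ω := by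
  have hc : Tendsto (fun t : ℝ => x + t • v) (𝓝[>] 0) (𝓝 x) := by
    have : Continuous fun t : ℝ => x + t • v := by fun_prop
    simpa using (this.tendsto 0).mono_left nhdsWithin_le_nhds
  filter_upwards [(h.tendsto_slope v).eventually_lt_const hv, hc.eventually h.2.2.2,
    eventually_mem_nhdsWithin] with t ht1 ht2 ht3
  rw [ht2]
  have : (0 : ℝ) < t⁻¹ := inv_pos.2 ht3
  by_contra! hcon
  exact absurd ht1 (not_lt.2 (mul_nonneg this.le hcon))

/-- The unit normal does not depend on the defining function: the half space of directions pointing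
into the domain determines it. -/
theorem IsLocalDefining.normalized_gradient_eq {ρ' : E n → ℝ} (h : IsLocalDefining Ω x ρ)
    (h' : IsLocalDefining Ω x ρ') :
    ‖gradient ρ x‖⁻¹ • gradient ρ x = ‖gradient ρ' x‖⁻¹ • gradient ρ' x := by
  set a := ‖gradient ρ x‖⁻¹ • gradient ρ x with ha
  set b := ‖gradient ρ' x‖⁻¹ • gradient ρ' x with hb
  have hpa : 0 < ‖gradient ρ x‖⁻¹ := inv_pos.2 (norm_pos_iff.2 h.2.1)
  have hpb : 0 < ‖gradient ρ' x‖⁻¹ := inv_pos.2 (norm_pos_iff.2 h'.2.1)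
  have hna : ‖a‖ = 1 := norm_smul_inv_norm h.2.1
  have hnb : ‖b‖ = 1 := norm_smul_inv_norm h'.2.1
  have key : ∀ v, inner ℝ a v < 0 → inner ℝ b v ≤ 0 := by
    intro v hv
    rw [ha, real_inner_smul_left, inner_gradient] at hv
    rw [hb, real_inner_smul_left, inner_gradient]
    have hv' : fderiv ℝ ρ x v < 0 := by
      by_contra! hcon
      exact absurd hv (not_lt.2 (mul_nonneg hpa.le hcon))
    refine mul_nonpos_of_nonneg_of_nonpos hpb.le ?_
    refine le_of_tendsto (h'.tendsto_slope v) ?_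
    have hc : Tendsto (fun t : ℝ => x + t • v) (𝓝[>] 0) (𝓝 x) := by
      have : Continuous fun t : ℝ => x + t • v := by fun_prop
      simpa using (this.tendsto 0).mono_left nhdsWithin_le_nhds
    filter_upwards [h.eventually_mem hv', hc.eventually h'.2.2.2, eventually_mem_nhdsWithin]
      with t h1 h2 h3
    exact mul_nonpos_of_nonneg_of_nonpos (inv_nonneg.2 (le_of_lt h3)) (h2.1 h1).le
  by_contra hne
  -- Two distinct unit vectors satisfy `⟨a, b⟩ < 1`, so that `v = b - a` violates `key`.
  have hlt : inner ℝ a b < 1 := (inner_lt_one_iff_real_of_norm_eq_one hna hnb).2 hne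
  have h1 := key (b - a) (by rw [inner_sub_right, real_inner_self_eq_norm_sq, hna]; linarith)
  rw [inner_sub_right, real_inner_self_eq_norm_sq, hnb, real_inner_comm] at h1
  linarith

theorem IsLocalDefining.euclNormal_eq (h : IsLocalDefining Ω x ρ) :
    euclNormal Ω x = ‖gradient ρ x‖⁻¹ • gradient ρ x := by
  obtain ⟨ρ', h', he⟩ := Classical.epsilon_spec
    (p := fun ν => ∃ ρ, IsLocalDefining Ω x ρ ∧ ν = ‖gradient ρ x‖⁻¹ • gradient ρ x) ⟨_, ρ, h, rfl⟩
  rw [euclNormal, he, h'.normalized_gradient_eq h]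

theorem norm_euclNormal (h : ∃ ρ, IsLocalDefining Ω x ρ) : ‖euclNormal Ω x‖ = 1 := by
  obtain ⟨ρ, h⟩ := h
  rw [h.euclNormal_eq]
  exact norm_smul_inv_norm h.2.1

/-- A defining function near a boundary point is a defining function at all nearby boundary
points. -/
theorem IsLocalDefining.eventually_frontier (hΩ : IsOpen Ω) (h : IsLocalDefining Ω x ρ) :
    ∀ᶠ y in 𝓝 x, y ∈ frontier Ω → IsLocalDefining Ω y ρ := by
  have h1 := h.1.eventually (by simp)
  have h2 : ∀ᶠ y in 𝓝 x, gradient ρ y ≠ 0 := by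
    have hc : ContinuousAt (gradient ρ) x := by
      have : ContinuousAt (fderiv ℝ ρ) x := (h.1.fderiv_right (m := 1) (by norm_num)).continuousAt
      exact ((InnerProductSpace.toDual ℝ (E n)).symm.continuous.continuousAt).comp this
    exact hc.eventually_ne h.2.1
  filter_upwards [h1, h2, h.2.2.2.eventually_nhds] with y hy1 hy2 hy3 hyf
  refine ⟨hy1, hy2, le_antisymm ?_ ?_, hy3⟩
  · have hcl : y ∈ closure Ω := frontier_subset_closure hyf
    have hfreq : ∃ᶠ z in 𝓝 y, z ∈ Ω := mem_closure_iff_frequently.1 hcl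
    exact le_of_tendsto_of_frequently hy1.continuousAt.tendsto
      ((hfreq.and_eventually hy3).mono fun z hz => (hz.2.1 hz.1).le)
  · by_contra! hlt
    have := hy3.self_of_nhds.2 hlt
    rw [hΩ.frontier_eq] at hyf
    exact hyf.2 this

theorem continuousOn_euclNormal (hΩ : IsOpen Ω) (hb : ∀ x ∈ frontier Ω, ∃ ρ, IsLocalDefining Ω x ρ) :
    ContinuousOn (euclNormal Ω) (frontier Ω) := by
  intro x hx
  obtain ⟨ρ, h⟩ := hb x hx
  have hc : ContinuousAt (gradient ρ) x := by
    have : ContinuousAt (fderiv ℝ ρ) x := (h.1.fderiv_right (m := 1) (by norm_num)).continuousAt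
    exact ((InnerProductSpace.toDual ℝ (E n)).symm.continuous.continuousAt).comp this
  have hc2 : ContinuousAt (fun y => ‖gradient ρ y‖⁻¹ • gradient ρ y) x :=
    (hc.norm.inv₀ (norm_ne_zero_iff.2 h.2.1)).smul hc
  refine hc2.continuousWithinAt.congr_of_eventuallyEq ?_ h.euclNormal_eq
  filter_upwards [mem_nhdsWithin_of_mem_nhds (h.eventually_frontier hΩ), self_mem_nhdsWithin]
    with y hy hyf
  exact (hy hyf).euclNormal_eq

/-- The closure of a `C²` domain has enough directions for derivatives within it to be unique. -/
theorem uniqueDiffOn_closure (hΩ : IsOpen Ω) (hb : ∀ x ∈ frontier Ω, ∃ ρ, IsLocalDefining Ω x ρ) :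
    UniqueDiffOn ℝ (closure Ω) := by
  intro x hx
  by_cases hxΩ : x ∈ Ω
  · exact (hΩ.uniqueDiffWithinAt hxΩ).mono subset_closure
  obtain ⟨ρ, h⟩ := hb x (by rw [hΩ.frontier_eq]; exact ⟨hx, hxΩ⟩)
  refine ⟨?_, subset_closure hx⟩
  have hcone : {v | fderiv ℝ ρ x v < 0} ⊆ tangentConeAt ℝ (closure Ω) x := by
    intro v hv
    exact mem_tangentConeAt_of_add_smul_mem (l := 𝓝[>] (0 : ℝ)) (c := id)
      (tendsto_id.mono_left (nhdsGT_le_nhdsNE _))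
      ((h.eventually_mem hv).mono fun t ht => subset_closure ht)
  have hspan : Submodule.span ℝ {v | fderiv ℝ ρ x v < 0} = ⊤ := by
    have hw : ∃ w, fderiv ℝ ρ x w < 0 := by
      refine ⟨-gradient ρ x, ?_⟩
      rw [map_neg, ← inner_gradient, real_inner_self_eq_norm_sq, neg_lt_zero]
      have := norm_pos_iff.2 h.2.1
      positivity
    have hopen : IsOpen {v | fderiv ℝ ρ x v < 0} :=
      isOpen_lt (fderiv ℝ ρ x).continuous continuous_const
    obtain ⟨w, hw⟩ := hw
    exact Submodule.eq_top_of_nonempty_interior' _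
      ⟨w, mem_interior.2 ⟨_, Submodule.subset_span, hopen, hw⟩⟩
  have := Submodule.span_mono (R := ℝ) hcone
  rw [hspan, top_le_iff] at this
  rw [this]
  exact dense_univ

end Boundary

/-! ### Local graphs -/

section LocalGraphs

open Set Filter Topology
open scoped ENNReal NNReal ContDiff
variable {d : ℕ}

/-- A function which is `C²` near a point agrees near that point with a globally `C²` function. -/
theorem exists_contDiff_eventuallyEq {ψ : E d → ℝ} {y₀ : E d} (hψ : ContDiffAt ℝ 2 ψ y₀) :
    ∃ φ : E d → ℝ, ContDiff ℝ 2 φ ∧ φ =ᶠ[𝓝 y₀] ψ := by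
  obtain ⟨r, hr, hball⟩ := Metric.eventually_nhds_iff_ball.1 (hψ.eventually (by simp))
  let χ : ContDiffBump y₀ := ⟨r / 3, r / 2, by positivity, by linarith⟩
  refine ⟨fun y => χ y * ψ y, contDiff_iff_contDiffAt.2 fun y => ?_, ?_⟩
  · by_cases hy : y ∈ tsupport fun y => χ y * ψ y
    swap
    · exact contDiffAt_const.congr_of_eventuallyEq (notMem_tsupport_iff_eventuallyEq.1 hy)
    have hy' : y ∈ tsupport χ := tsupport_mul_subset_left hy
    rw [χ.tsupport_eq] at hy'
    have : y ∈ Metric.ball y₀ r := Metric.closedBall_subset_ball (by simp [χ]; linarith) hy'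
    exact (χ.contDiffAt (n := 2)).mul (hball y this)
  · filter_upwards [χ.eventuallyEq_one] with y hy
    simp [hy]

/-- Near a boundary point, a `C²` domain is the set below or above the graph of a `C²` function of
all but one of the coordinates. -/
theorem IsLocalDefining.exists_graph {Ω : Set (E (d + 1))} {x₀ : E (d + 1)} {ρ : E (d + 1) → ℝ}
    (h : IsLocalDefining Ω x₀ ρ) : ∃ (i : Fin (d + 1)) (φ : E d → ℝ) (ε : ℝ),
      ContDiff ℝ 2 φ ∧ (ε = 1 ∨ ε = -1) ∧
        ∀ᶠ x in 𝓝 x₀, (x ∈ Ω ↔ ε * (x i - φ (dropCoord i x)) < 0) := by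
  obtain ⟨hρ, hgrad, h0, hΩ⟩ := h
  obtain ⟨i, hi⟩ : ∃ i, fderiv ℝ ρ x₀ (EuclideanSpace.single i 1) ≠ 0 := by
    by_contra! hall
    refine hgrad ?_
    ext j
    rw [gradient_coord, hall j]; rfl
  obtain ⟨ε, hε, hεi⟩ : ∃ ε : ℝ, (ε = 1 ∨ ε = -1) ∧
      0 < ε * fderiv ℝ ρ x₀ (EuclideanSpace.single i 1) := by
    rcases lt_or_gt_of_ne hi with hlt | hgt
    · exact ⟨-1, Or.inr rfl, by linarith⟩
    · exact ⟨1, Or.inl rfl, by linarith⟩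
  set S : E d × ℝ →L[ℝ] E (d + 1) :=
    (ContinuousLinearMap.snd ℝ (E d) ℝ).smulRight (EuclideanSpace.single i 1) +
      (liftCoord i).comp (ContinuousLinearMap.fst ℝ (E d) ℝ) with hS
  have hSapp : ∀ y t, S (y, t) = insCoord i t y := fun y t => by rw [insCoord_eq]; rfl
  set u : E d × ℝ := (dropCoord i x₀, x₀ i) with hu
  have hSu : S u = x₀ := by rw [hu, hSapp, insCoord_dropCoord]
  have cdf : ContDiffAt ℝ 2 (ρ ∘ S) u :=
    ContDiffAt.comp u (by rwa [hSu]) S.contDiff.contDiffAt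
  have hfd : fderiv ℝ (ρ ∘ S) u = (fderiv ℝ ρ x₀).comp S := by
    have h1 : HasFDerivAt ρ (fderiv ℝ ρ x₀) (S u) := by
      rw [hSu]; exact (hρ.differentiableAt two_ne_zero).hasFDerivAt
    exact (h1.comp u S.hasFDerivAt).fderiv
  have if₂ : (fderiv ℝ (ρ ∘ S) u ∘L .inr ℝ (E d) ℝ).IsInvertible := by
    rw [hfd]
    refine ⟨ContinuousLinearEquiv.unitsEquivAut ℝ (Units.mk0 _ hi), ?_⟩
    ext
    simp [hS]
  set ψ := cdf.implicitFunction two_ne_zero if₂ with hψ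
  have hψu : ψ (dropCoord i x₀) = x₀ i := cdf.implicitFunction_apply_self two_ne_zero if₂
  have hψ0 : ∀ᶠ y in 𝓝 (dropCoord i x₀), ρ (insCoord i (ψ y) y) = 0 := by
    filter_upwards [cdf.eventually_apply_implicitFunction two_ne_zero if₂] with y hy
    rwa [Function.comp_apply, Function.comp_apply, hSapp, hSu, h0] at hy
  obtain ⟨φ, hφ, hφψ⟩ := exists_contDiff_eventuallyEq
    (cdf.contDiffAt_implicitFunction two_ne_zero if₂)
  have hφ0 : ∀ᶠ y in 𝓝 (dropCoord i x₀), ρ (graphMap i φ y) = 0 := by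
    filter_upwards [hψ0, hφψ] with y hy1 hy2
    rwa [graphMap, hy2]
  have hφx : graphMap i φ (dropCoord i x₀) = x₀ := by
    rw [graphMap, hφψ.self_of_nhds]
    exact (congrArg (fun t => insCoord i t (dropCoord i x₀)) hψu).trans (insCoord_dropCoord i x₀)
  refine ⟨i, φ, ε, hφ, hε, ?_⟩
  have hmono : ∀ᶠ x in 𝓝 x₀, 0 < ε * fderiv ℝ ρ x (EuclideanSpace.single i 1) := by
    have hc : ContinuousAt (fderiv ℝ ρ) x₀ := (hρ.fderiv_right (m := 1) (by norm_num)).continuousAt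
    have hc2 : ContinuousAt (fun x => ε * fderiv ℝ ρ x (EuclideanSpace.single i 1)) x₀ :=
      continuousAt_const.mul (hc.clm_apply continuousAt_const)
    exact hc2.eventually_const_lt hεi
  have hdiff : ∀ᶠ x in 𝓝 x₀, DifferentiableAt ℝ ρ x :=
    (hρ.eventually (by simp)).mono fun x hx => hx.differentiableAt two_ne_zero
  obtain ⟨r, hr, hN⟩ := Metric.eventually_nhds_iff_ball.1 (hΩ.and (hmono.and hdiff))
  have hdrop : Tendsto (dropCoord i) (𝓝 x₀) (𝓝 (dropCoord i x₀)) :=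
    (dropCoord i).continuous.tendsto x₀
  have hgr : ∀ᶠ x in 𝓝 x₀, graphMap i φ (dropCoord i x) ∈ Metric.ball x₀ r := by
    have hc : ContinuousAt (fun x => graphMap i φ (dropCoord i x)) x₀ :=
      ((continuous_graphMap i hφ.continuous).comp (dropCoord i).continuous).continuousAt
    exact hc.eventually_mem (Metric.isOpen_ball.mem_nhds (by simpa [hφx] using hr))
  filter_upwards [Metric.ball_mem_nhds x₀ hr, hgr, hdrop.eventually hφ0] with x hx1 hx2 hx3
  rw [(hN x hx1).1]
  set y := dropCoord i x
  have hxy : insCoord i (x i) y = x := insCoord_dropCoord i x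
  have hline : Continuous fun t : ℝ => insCoord i t y := by
    simp_rw [insCoord_eq]; fun_prop
  set I : Set ℝ := {t | insCoord i t y ∈ Metric.ball x₀ r} with hI
  have hIo : IsOpen I := Metric.isOpen_ball.preimage hline
  have hIc : Convex ℝ I := by
    intro s hs t ht a b ha hb hab
    have := (convex_ball x₀ r) hs ht ha hb hab
    have he : insCoord i (a • s + b • t) y = a • insCoord i s y + b • insCoord i t y := by
      rw [insCoord_eq, insCoord_eq, insCoord_eq, smul_add, smul_add, add_add_add_comm, ← add_smul,
        hab, one_smul, smul_smul, smul_smul, ← add_smul]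
      simp
    rw [hI, mem_ofPred_eq, he]
    exact this
  have hder : ∀ t ∈ I, HasDerivAt (fun t => ε * ρ (insCoord i t y))
      (ε * fderiv ℝ ρ (insCoord i t y) (EuclideanSpace.single i 1)) t := by
    intro t ht
    have hl : HasDerivAt (fun t : ℝ => insCoord i t y) (EuclideanSpace.single i 1) t := by
      simp_rw [insCoord_eq]
      simpa using ((hasDerivAt_id t).smul_const (EuclideanSpace.single i (1 : ℝ))).add_const
        (liftCoord i y)
    exact ((hN _ ht).2.2.hasFDerivAt.comp_hasDerivAt t hl).const_mul ε
  -- On the segment from the graph to `x` the defining function has a sign.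
  have hsm : StrictMonoOn (fun t => ε * ρ (insCoord i t y)) I := by
    refine strictMonoOn_of_deriv_pos hIc
      (fun t ht => (hder t ht).continuousAt.continuousWithinAt) fun t ht => ?_
    rw [hIo.interior_eq] at ht
    rw [(hder t ht).deriv]
    exact (hN _ ht).2.1
  have hxI : x i ∈ I := by rw [hI, mem_ofPred_eq, hxy]; exact hx1
  have hφI : φ y ∈ I := hx2
  have hρφ : ρ (insCoord i (φ y) y) = 0 := hx3
  rcases hε with rfl | rfl
  · have := hsm.lt_iff_lt hxI hφI
    simp only [hxy, hρφ, one_mul] at this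
    rw [this, one_mul, sub_neg]
  · have := hsm.lt_iff_lt hφI hxI
    simp only [hxy, hρφ] at this
    constructor
    · intro h; linarith [this.1 (by linarith)]
    · intro h; linarith [this.2 (by linarith)]

/-- The outer unit normal `ε (e_i - ∇φ) / √(1 + |∇φ|²)` of the set below or above a graph. -/
theorem euclNormal_graph {Ω : Set (E (d + 1))} {i : Fin (d + 1)} {φ : E d → ℝ} {ε : ℝ}
    (hφ : ContDiff ℝ 2 φ) (hε : ε = 1 ∨ ε = -1) {x : E (d + 1)}
    (hx : x i = φ (dropCoord i x))
    (hΩ : ∀ᶠ y in 𝓝 x, (y ∈ Ω ↔ ε * (y i - φ (dropCoord i y)) < 0)) :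
    euclNormal Ω x i = ε / graphJac φ (dropCoord i x) ∧
      ∀ j, euclNormal Ω x (i.succAbove j) =
        - (ε * fderiv ℝ φ (dropCoord i x) (EuclideanSpace.single j 1)) /
          graphJac φ (dropCoord i x) := by
  set ρ : E (d + 1) → ℝ := fun y => ε * (y i - φ (dropCoord i y)) with hρ
  have hεε : ε * ε = 1 := by rcases hε with rfl | rfl <;> norm_num
  have hε0 : ε ≠ 0 := by rintro rfl; simp at hεε
  have hder : HasFDerivAt ρ (ε • ((EuclideanSpace.proj i : E (d + 1) →L[ℝ] ℝ) -
      (fderiv ℝ φ (dropCoord i x)).comp (dropCoord i))) x :=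
    ((hasFDerivAt_coord i x).sub (((hφ.differentiable two_ne_zero) _).hasFDerivAt.comp x
      (dropCoord i).hasFDerivAt)).const_mul ε
  have hgi : gradient ρ x i = ε := by
    rw [gradient_coord, hder.fderiv]; simp
  have hgj : ∀ j, gradient ρ x (i.succAbove j) =
      - (ε * fderiv ℝ φ (dropCoord i x) (EuclideanSpace.single j 1)) := fun j => by
    rw [gradient_coord, hder.fderiv]; simp
  have hdef : IsLocalDefining Ω x ρ := by
    refine ⟨?_, ?_, by simp [hρ, hx], hΩ⟩
    · have : ContDiff ℝ 2 ρ := contDiff_const.mul (ContDiff.sub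
        (EuclideanSpace.proj i : E (d + 1) →L[ℝ] ℝ).contDiff (hφ.comp (dropCoord i).contDiff))
      exact this.contDiffAt
    · intro h0
      rw [h0] at hgi
      exact hε0 hgi.symm
  have hnorm : ‖gradient ρ x‖ = graphJac φ (dropCoord i x) := by
    rw [EuclideanSpace.norm_eq, graphJac]
    congr 1
    rw [Fin.sum_univ_succAbove _ i, hgi]
    simp_rw [hgj, Real.norm_eq_abs, sq_abs, neg_sq, mul_pow, sq ε, hεε, one_mul]
  refine ⟨?_, fun j => ?_⟩
  · rw [hdef.euclNormal_eq, hnorm, PiLp.smul_apply, hgi, smul_eq_mul, div_eq_inv_mul]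
  · rw [hdef.euclNormal_eq, hnorm, PiLp.smul_apply, hgj, smul_eq_mul, div_eq_inv_mul]

end LocalGraphs

/-! ### The divergence theorem on bounded `C²` domains -/

section Divergence

open Set Filter Topology
open scoped ENNReal NNReal ContDiff Manifold
variable {d : ℕ}

/-- The divergence theorem for fields supported near a boundary point, where the domain lies on
one side of a graph. -/
theorem divergence_theorem_of_graph {Ω : Set (E (d + 1))} (hΩ : IsOpen Ω) {i : Fin (d + 1)}
    {φ : E d → ℝ} {ε : ℝ} (hφ : ContDiff ℝ 2 φ) (hε : ε = 1 ∨ ε = -1) {Q K : Set (E (d + 1))}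
    (hQ : IsOpen Q) (hQΩ : ∀ x ∈ Q, (x ∈ Ω ↔ ε * (x i - φ (dropCoord i x)) < 0))
    (hK : IsClosed K) (hKb : Bornology.IsBounded K) (hKQ : K ⊆ Q)
    {Y : Fin (d + 1) → E (d + 1) → ℝ}
    (hsupp : ∀ j x, x ∉ K → Y j x = 0) (hc : ∀ j, ContinuousOn (Y j) (closure Ω))
    (hd : ∀ j, ∀ x ∈ Ω, DifferentiableAt ℝ (Y j) x) (hi : IntegrableOn (euclDiv Y) Ω) :
    ∫ x in Ω, euclDiv Y x = ∫ x in frontier Ω, ∑ j, Y j x * euclNormal Ω x j ∂μHE[d] ∧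
      IntegrableOn (fun x => ∑ j, Y j x * euclNormal Ω x j) (frontier Ω) μHE[d] := by
  have hεε : ε * ε = 1 := by rcases hε with rfl | rfl <;> norm_num
  have hφc := hφ.continuous
  obtain ⟨R, hR0, hR⟩ : ∃ R, 0 ≤ R ∧ ∀ x ∈ K, ‖x‖ ≤ R := by
    obtain ⟨R, hR⟩ := hKb.exists_norm_le
    exact ⟨|R|, abs_nonneg R, fun x hx => (hR x hx).trans (le_abs_self R)⟩
  have hsuppR : ∀ j x, R < ‖x‖ → Y j x = 0 := fun j x hx =>
    hsupp j x fun hxK => absurd (hR x hxK) (not_le.2 hx)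
  have hev : ∀ j, ∀ x ∉ K, Y j =ᶠ[𝓝 x] 0 := fun j x hx =>
    (hK.isOpen_compl.eventually_mem hx).mono fun y hy => hsupp j y hy
  set f : E (d + 1) → ℝ := fun x => ε * (x i - φ (dropCoord i x)) with hf
  have hfc : Continuous f := by
    have : Continuous fun x : E (d + 1) => x i := (EuclideanSpace.proj i).continuous
    exact continuous_const.mul (this.sub (hφc.comp (dropCoord i).continuous))
  set Ωφ : Set (E (d + 1)) := {x | f x < 0} with hΩφ
  have hΩφo : IsOpen Ωφ := isOpen_lt hfc continuous_const
  have hgr : ∀ y, f (graphMap i φ y) = 0 := fun y => by simp [hf, graphMap]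
  have hfr : ∀ x, f x = 0 ↔ x ∈ range (graphMap i φ) := by
    intro x
    constructor
    · intro h0
      have hε0 : ε ≠ 0 := by rintro rfl; simp at hεε
      have : x i = φ (dropCoord i x) := sub_eq_zero.1 ((mul_eq_zero.1 h0).resolve_left hε0)
      refine ⟨dropCoord i x, ?_⟩
      rw [graphMap, ← this, insCoord_dropCoord]
    · rintro ⟨y, rfl⟩
      exact hgr y
  -- Moving off the graph in the direction `-ε e_i` enters the domain.
  have hclos : ∀ x ∈ Q, f x ≤ 0 → x ∈ closure Ω := by
    intro x hxQ hx
    have hcl : Continuous fun t : ℝ => x + t • ((-ε) • EuclideanSpace.single i (1 : ℝ)) := by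
      fun_prop
    have ht : Tendsto (fun t : ℝ => x + t • ((-ε) • EuclideanSpace.single i (1 : ℝ))) (𝓝[>] 0)
        (𝓝 x) := by
      simpa using (hcl.tendsto 0).mono_left nhdsWithin_le_nhds
    refine mem_closure_of_tendsto ht ?_
    filter_upwards [ht.eventually (hQ.mem_nhds hxQ), eventually_mem_nhdsWithin] with t htQ ht0
    rw [hQΩ _ htQ]
    have : f (x + t • ((-ε) • EuclideanSpace.single i (1 : ℝ))) = f x - t := by
      simp only [hf, PiLp.add_apply, PiLp.smul_apply, map_add, map_smul, dropCoord_single_same,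
        smul_zero, add_zero, PiLp.single_apply, if_true, smul_eq_mul, mul_one]
      linear_combination -t * hεε
    change f _ < 0
    rw [this]
    have : (0 : ℝ) < t := ht0
    linarith
  have hfront : ∀ x ∈ Q, (x ∈ frontier Ω ↔ x ∈ range (graphMap i φ)) := by
    intro x hxQ
    rw [hΩ.frontier_eq, ← hfr]
    constructor
    · rintro ⟨hcl, hnot⟩
      refine le_antisymm ?_ (not_lt.1 fun hlt => hnot ((hQΩ x hxQ).2 hlt))
      refine le_of_tendsto_of_frequently hfc.continuousAt.tendsto
        (((mem_closure_iff_frequently.1 hcl).and_eventually (hQ.eventually_mem hxQ)).mono ?_)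
      rintro z ⟨hz, hzQ⟩
      exact ((hQΩ z hzQ).1 hz).le
    · intro h0
      exact ⟨hclos x hxQ h0.le, fun hxΩ => absurd ((hQΩ x hxQ).1 hxΩ) (by rw [← hf] at *; exact not_lt.2 h0.ge)⟩
  have hdiv0 : ∀ x ∉ K, euclDiv Y x = 0 := fun x hx => euclDiv_eq_zero fun j => hev j x hx
  have hint : IntegrableOn (euclDiv Y) Ωφ :=
    hi.of_forall_sdiff_eq_zero hΩφo.measurableSet fun x hx => hdiv0 x fun hxK =>
      hx.2 ((hQΩ x (hKQ hxK)).2 hx.1)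
  have hlhs : ∫ x in Ω, euclDiv Y x = ∫ x in Ωφ, euclDiv Y x := by
    have h1 : ∫ x in Ω, euclDiv Y x = ∫ x in Ω ∩ Q, euclDiv Y x :=
      setIntegral_eq_of_subset_of_forall_sdiff_eq_zero hΩ.measurableSet inter_subset_left
        fun x hx => hdiv0 x fun hxK => hx.2 ⟨hx.1, hKQ hxK⟩
    have h2 : ∫ x in Ωφ, euclDiv Y x = ∫ x in Ωφ ∩ Q, euclDiv Y x :=
      setIntegral_eq_of_subset_of_forall_sdiff_eq_zero hΩφo.measurableSet inter_subset_left
        fun x hx => hdiv0 x fun hxK => hx.2 ⟨hx.1, hKQ hxK⟩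
    rw [h1, h2]
    congr 2
    ext x
    exact ⟨fun h => ⟨(hQΩ x h.2).1 h.1, h.2⟩, fun h => ⟨(hQΩ x h.2).2 h.1, h.2⟩⟩
  have hcY : ∀ j, ContinuousOn (Y j) {x | f x ≤ 0} := by
    intro j x hx
    by_cases hxK : x ∈ K
    · refine (hc j x (hclos x (hKQ hxK) hx)).mono_of_mem_nhdsWithin ?_
      filter_upwards [mem_nhdsWithin_of_mem_nhds (hQ.mem_nhds (hKQ hxK)), self_mem_nhdsWithin]
        with y hyQ hy using hclos y hyQ hy
    · exact (continuousAt_const.congr (hev j x hxK).symm).continuousWithinAt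
  have hdY : ∀ j x, f x < 0 → DifferentiableAt ℝ (Y j) x := by
    intro j x hx
    by_cases hxK : x ∈ K
    · exact hd j x ((hQΩ x (hKQ hxK)).2 hx)
    · exact (differentiableAt_const (0 : ℝ)).congr_of_eventuallyEq (hev j x hxK)
  have hmain := setIntegral_euclDiv_graph i hφ hε hR0 hsuppR hcY hdY hint
  set g : E (d + 1) → ℝ := fun x => ∑ j, Y j x * euclNormal Ω x j with hg
  have hg0 : ∀ x ∉ K, g x = 0 := fun x hx => Finset.sum_eq_zero fun j _ => by
    rw [hsupp j x hx, zero_mul]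
  have hgφ : ∀ y, graphJac φ y * g (graphMap i φ y) =
      ε * (Y i (graphMap i φ y) - ∑ j, fderiv ℝ φ y (EuclideanSpace.single j 1) *
        Y (i.succAbove j) (graphMap i φ y)) := by
    intro y
    by_cases hyK : graphMap i φ y ∈ K
    · have hev' : ∀ᶠ z in 𝓝 (graphMap i φ y), (z ∈ Ω ↔ ε * (z i - φ (dropCoord i z)) < 0) :=
        (hQ.eventually_mem (hKQ hyK)).mono hQΩ
      have hdrop : dropCoord i (graphMap i φ y) = y := dropCoord_insCoord _ _ _
      obtain ⟨h1, h2⟩ := euclNormal_graph (Ω := Ω) hφ hε (x := graphMap i φ y)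
        (by rw [hdrop, graphMap, insCoord_same]) hev'
      rw [hdrop] at h1 h2
      have hJ := (graphJac_pos φ y).ne'
      rw [hg]
      simp only
      rw [Fin.sum_univ_succAbove _ i, h1]
      simp_rw [h2]
      rw [mul_add, mul_sub, Finset.mul_sum, Finset.mul_sum, sub_eq_add_neg,
        ← Finset.sum_neg_distrib]
      congr 1
      · field_simp
      · exact Finset.sum_congr rfl fun j _ => by field_simp
    · rw [hg0 _ hyK]
      simp [hsupp _ _ hyK]
  have hcont : Continuous fun y => graphJac φ y * g (graphMap i φ y) := by
    simp_rw [hgφ]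
    have hYg : ∀ j, Continuous fun y => Y j (graphMap i φ y) := fun j =>
      (hcY j).comp_continuous (continuous_graphMap i hφc) fun y => (hgr y).le
    have := hφ.continuous_fderiv two_ne_zero
    have := hYg i
    refine continuous_const.mul ((hYg i).sub (continuous_finsetSum _ fun j _ => ?_))
    exact Continuous.mul (by fun_prop) (hYg _)
  have hcs : HasCompactSupport fun y => graphJac φ y * g (graphMap i φ y) := by
    refine HasCompactSupport.of_support_subset_isCompact (isCompact_closedBall (0 : E d) R) ?_
    intro y hy
    by_contra hyR
    refine hy ?_
    have : graphMap i φ y ∉ K := fun hK' => hyR (by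
      have h1 := norm_dropCoord_le i (graphMap i φ y)
      rw [graphMap, dropCoord_insCoord, ← graphMap] at h1
      simpa using h1.trans (hR _ hK'))
    simp [hg0 _ this]
  have hφ1 : ContDiff ℝ 1 φ := hφ.of_le (by norm_num)
  have hintg : IntegrableOn g (range (graphMap i φ)) μHE[d] :=
    integrableOn_graph i hφ1 (hcont.integrable_of_hasCompactSupport hcs)
  have hrm : MeasurableSet (range (graphMap i φ)) :=
    (measurableEmbedding_graphMap i hφc).measurableSet_range
  have hfm : MeasurableSet (frontier Ω) := isClosed_frontier.measurableSet
  refine ⟨?_, hintg.of_forall_sdiff_eq_zero hfm fun x hx => hg0 x fun hxK =>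
    hx.2 ((hfront x (hKQ hxK)).1 hx.1)⟩
  rw [hlhs, hmain]
  have h1 : ∫ x in frontier Ω, g x ∂μHE[d] = ∫ x in frontier Ω ∩ Q, g x ∂μHE[d] :=
    setIntegral_eq_of_subset_of_forall_sdiff_eq_zero hfm inter_subset_left
      fun x hx => hg0 x fun hxK => hx.2 ⟨hx.1, hKQ hxK⟩
  have h2 : ∫ x in range (graphMap i φ), g x ∂μHE[d] =
      ∫ x in range (graphMap i φ) ∩ Q, g x ∂μHE[d] :=
    setIntegral_eq_of_subset_of_forall_sdiff_eq_zero hrm inter_subset_left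
      fun x hx => hg0 x fun hxK => hx.2 ⟨hx.1, hKQ hxK⟩
  have h3 : frontier Ω ∩ Q = range (graphMap i φ) ∩ Q := by
    ext x
    exact ⟨fun h => ⟨(hfront x h.2).1 h.1, h.2⟩, fun h => ⟨(hfront x h.2).2 h.1, h.2⟩⟩
  rw [h1, h3, ← h2, integral_graph i hφ1]
  simp_rw [hgφ]

/-- The divergence theorem for fields supported inside the domain. -/
theorem divergence_theorem_of_interior {Ω : Set (E (d + 1))} (hΩ : IsOpen Ω) {K : Set (E (d + 1))}
    (hK : IsClosed K) (hKb : Bornology.IsBounded K) (hKΩ : K ⊆ Ω) {Y : Fin (d + 1) → E (d + 1) → ℝ}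
    (hsupp : ∀ j x, x ∉ K → Y j x = 0)
    (hd : ∀ j, ∀ x ∈ Ω, DifferentiableAt ℝ (Y j) x) (hi : IntegrableOn (euclDiv Y) Ω) :
    ∫ x in Ω, euclDiv Y x = ∫ x in frontier Ω, ∑ j, Y j x * euclNormal Ω x j ∂μHE[d] ∧
      IntegrableOn (fun x => ∑ j, Y j x * euclNormal Ω x j) (frontier Ω) μHE[d] := by
  have hg0 : ∀ x ∈ frontier Ω, ∑ j, Y j x * euclNormal Ω x j = 0 := by
    intro x hx
    rw [hΩ.frontier_eq] at hx
    exact Finset.sum_eq_zero fun j _ => by rw [hsupp j x fun h => hx.2 (hKΩ h), zero_mul]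
  have hfm : MeasurableSet (frontier Ω) := isClosed_frontier.measurableSet
  refine ⟨?_, (integrableOn_zero (s := frontier Ω)).congr_fun (fun x hx => (hg0 x hx).symm) hfm⟩
  rw [setIntegral_congr_fun hfm hg0, integral_zero]
  obtain ⟨R, hR0, hR⟩ : ∃ R, 0 ≤ R ∧ ∀ x ∈ K, ‖x‖ ≤ R := by
    obtain ⟨R, hR⟩ := hKb.exists_norm_le
    exact ⟨|R|, abs_nonneg R, fun x hx => (hR x hx).trans (le_abs_self R)⟩
  have hev : ∀ j, ∀ x ∉ K, Y j =ᶠ[𝓝 x] 0 := fun j x hx =>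
    (hK.isOpen_compl.eventually_mem hx).mono fun y hy => hsupp j y hy
  have hdY : ∀ j x, DifferentiableAt ℝ (Y j) x := by
    intro j x
    by_cases hxK : x ∈ K
    · exact hd j x (hKΩ hxK)
    · exact (differentiableAt_const (0 : ℝ)).congr_of_eventuallyEq (hev j x hxK)
  have hdiv0 : ∀ x ∉ K, euclDiv Y x = 0 := fun x hx => euclDiv_eq_zero fun j => hev j x hx
  -- The support lies below the flat graph of the constant `R + 1`.
  have hΩφ : MeasurableSet {x : E (d + 1) | (1 : ℝ) * (x 0 - (fun _ : E d => R + 1)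
      (dropCoord 0 x)) < 0} := by
    refine (isOpen_lt ?_ continuous_const).measurableSet
    have : Continuous fun x : E (d + 1) => x 0 := (EuclideanSpace.proj 0).continuous
    fun_prop
  have hKlt : ∀ x ∈ K, x ∈ {x : E (d + 1) | (1 : ℝ) * (x 0 - (fun _ : E d => R + 1)
      (dropCoord 0 x)) < 0} := by
    intro x hx
    have h1 := (le_abs_self _).trans ((PiLp.norm_apply_le x 0).trans (hR x hx))
    simp only [mem_ofPred_eq]
    linarith
  have hmain := setIntegral_euclDiv_graph (0 : Fin (d + 1)) (φ := fun _ => R + 1) contDiff_const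
    (Or.inl rfl) hR0 (fun j x hx => hsupp j x fun hxK => absurd (hR x hxK) (not_le.2 hx))
    (fun j x _ => (hdY j x).continuousAt.continuousWithinAt) (fun j x _ => hdY j x)
    (hi.of_forall_sdiff_eq_zero hΩφ fun x hx => hdiv0 x fun hxK => hx.2 (hKΩ hxK))
  have h0 : ∀ j y, Y j (graphMap 0 (fun _ : E d => R + 1) y) = 0 := by
    intro j y
    refine hsupp j _ fun hyK => ?_
    have := hKlt _ hyK
    simp [graphMap] at this
  simp_rw [h0] at hmain
  have hfull : ∀ s : Set (E (d + 1)), MeasurableSet s → K ⊆ s →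
      ∫ x in s, euclDiv Y x = ∫ x in K, euclDiv Y x := fun s hs hKs =>
    setIntegral_eq_of_subset_of_forall_sdiff_eq_zero hs hKs fun x hx => hdiv0 x hx.2
  rw [hfull _ hΩ.measurableSet hKΩ, ← hfull _ hΩφ hKlt, hmain]
  simp

/-- **Divergence theorem** on a bounded `C²` domain, with the Hausdorff measure on the boundary, for
vector fields which are continuous up to the boundary, differentiable inside and have an integrable
divergence. -/
theorem divergence_theorem {Ω : Set (E (d + 1))} (hΩ : IsOpen Ω) (hb : Bornology.IsBounded Ω)
    (hbd : ∀ x ∈ frontier Ω, ∃ ρ, IsLocalDefining Ω x ρ) {X : Fin (d + 1) → E (d + 1) → ℝ}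
    (hc : ∀ j, ContinuousOn (X j) (closure Ω)) (hd : ∀ j, ∀ x ∈ Ω, DifferentiableAt ℝ (X j) x)
    (hi : IntegrableOn (euclDiv X) Ω) :
    ∫ x in Ω, euclDiv X x = ∫ x in frontier Ω, ∑ j, X j x * euclNormal Ω x j ∂μHE[d] := by
  have hcomp : IsCompact (closure Ω) := hb.isCompact_closure
  -- Every point of the closure has a neighbourhood for which the theorem holds.
  have hloc : ∀ x ∈ closure Ω, ∃ U : Set (E (d + 1)), IsOpen U ∧ x ∈ U ∧
      ∀ Y : Fin (d + 1) → E (d + 1) → ℝ, ∀ K ⊆ U, IsClosed K →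
        (∀ j x, x ∉ K → Y j x = 0) → (∀ j, ContinuousOn (Y j) (closure Ω)) →
        (∀ j, ∀ x ∈ Ω, DifferentiableAt ℝ (Y j) x) → IntegrableOn (euclDiv Y) Ω →
        ∫ x in Ω, euclDiv Y x = ∫ x in frontier Ω, ∑ j, Y j x * euclNormal Ω x j ∂μHE[d] ∧
        IntegrableOn (fun x => ∑ j, Y j x * euclNormal Ω x j) (frontier Ω) μHE[d] := by
    intro x hx
    by_cases hxΩ : x ∈ Ω
    · exact ⟨Ω, hΩ, hxΩ, fun Y K hKU hK hs _ hdY hiY =>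
        divergence_theorem_of_interior hΩ hK (hb.subset hKU) hKU hs hdY hiY⟩
    · obtain ⟨ρ, hρ⟩ := hbd x (by rw [hΩ.frontier_eq]; exact ⟨hx, hxΩ⟩)
      obtain ⟨i, φ, ε, hφ, hε, hev⟩ := hρ.exists_graph
      obtain ⟨r, hr, hball⟩ := Metric.eventually_nhds_iff_ball.1 hev
      exact ⟨Metric.ball x r, Metric.isOpen_ball, Metric.mem_ball_self hr,
        fun Y K hKU hK hs hcY hdY hiY => divergence_theorem_of_graph hΩ hφ hε Metric.isOpen_ball
          hball hK (Metric.isBounded_ball.subset hKU) hKU hs hcY hdY hiY⟩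
  choose! U hUo hxU hU using hloc
  obtain ⟨t, ht, htc⟩ := hcomp.elim_nhds_subcover U fun x hx => (hUo x hx).mem_nhds (hxU x hx)
  obtain ⟨η, hη⟩ := SmoothPartitionOfUnity.exists_isSubordinate 𝓘(ℝ, E (d + 1))
    hcomp.isClosed (fun a : t => U a) (fun a => hUo a (ht a a.2))
    (htc.trans (iUnion₂_subset fun x hx => subset_iUnion (fun a : t => U a) ⟨x, hx⟩))
  have hηs : ∀ a, ContDiff ℝ ∞ (η a) := fun a => (η a).contMDiff.contDiff
  have hηd : ∀ a, Differentiable ℝ (η a) := fun a => (hηs a).differentiable (by simp)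
  have hsum : ∀ x ∈ closure Ω, ∑ a, η a x = 1 := fun x hx => by
    rw [← finsum_eq_sum_of_fintype]
    exact η.sum_eq_one hx
  have hdivη : ∀ a, ∀ x ∈ Ω, euclDiv (fun j y => η a y * X j y) x = η a x * euclDiv X x +
      ∑ j, X j x * fderiv ℝ (η a) x (EuclideanSpace.single j 1) := by
    intro a x hx
    rw [euclDiv, euclDiv, Finset.mul_sum, ← Finset.sum_add_distrib]
    refine Finset.sum_congr rfl fun j _ => ?_
    rw [fderiv_fun_mul (hηd a x) (hd j x hx)]
    simp
  have hintη : ∀ a, IntegrableOn (euclDiv fun j y => η a y * X j y) Ω := by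
    intro a
    refine IntegrableOn.congr_fun ?_ (fun x hx => (hdivη a x hx).symm) hΩ.measurableSet
    refine Integrable.add ?_ ?_
    · refine Integrable.bdd_mul (c := 1) hi (hηs a).continuous.aestronglyMeasurable
        (Eventually.of_forall fun x => ?_)
      rw [Real.norm_eq_abs, abs_of_nonneg (η.nonneg a x)]
      exact η.le_one a x
    · have hcf : Continuous (fderiv ℝ (η a)) := (hηs a).continuous_fderiv (by simp)
      refine IntegrableOn.mono_set (ContinuousOn.integrableOn_compact hcomp ?_) subset_closure
      exact continuousOn_finsetSum _ fun j _ => (hc j).mul (by fun_prop)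
  have hall : ∀ a : t, _ := fun a => hU a (ht a a.2) (fun j y => η a y * X j y) (tsupport (η a))
    (hη a) (isClosed_tsupport _) (fun j x hx => by rw [image_eq_zero_of_notMem_tsupport hx, zero_mul])
    (fun j => (hηs a).continuous.continuousOn.mul (hc j))
    (fun j x hx => (hηd a x).mul (hd j x hx)) (hintη a)
  have hL : ∫ x in Ω, euclDiv X x = ∑ a, ∫ x in Ω, euclDiv (fun j y => η a y * X j y) x := by
    rw [← integral_finsetSum _ fun a _ => hintη a]
    refine setIntegral_congr_fun hΩ.measurableSet fun x hx => ?_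
    rw [Finset.sum_congr rfl fun a _ => hdivη a x hx, Finset.sum_add_distrib, ← Finset.sum_mul,
      hsum x (subset_closure hx), one_mul, Finset.sum_comm, left_eq_add]
    refine Finset.sum_eq_zero fun j _ => ?_
    rw [← Finset.mul_sum]
    -- The derivatives of a partition of unity add up to zero.
    have hconst : (fun y => ∑ a, η a y) =ᶠ[𝓝 x] fun _ => (1 : ℝ) :=
      (hΩ.eventually_mem hx).mono fun y hy => hsum y (subset_closure hy)
    have := hconst.fderiv_eq (𝕜 := ℝ)
    rw [fderiv_fun_sum fun a _ => hηd a x, fderiv_const_apply] at this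
    have h2 := DFunLike.congr_fun this (EuclideanSpace.single j 1)
    rw [_root_.sum_apply] at h2
    refine (congrArg _ h2).trans ?_
    simp
  rw [hL, Finset.sum_congr rfl fun a _ => (hall a).1, ← integral_finsetSum _ fun a _ => (hall a).2]
  refine setIntegral_congr_fun isClosed_frontier.measurableSet fun x hx => ?_
  simp only
  rw [Finset.sum_comm]
  refine Finset.sum_congr rfl fun j _ => ?_
  simp_rw [mul_assoc]
  rw [← Finset.sum_mul, hsum x (frontier_subset_closure hx), one_mul]

end Divergence

/-! ### The tensor `D²u - u I` in the hyperboloid chart -/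

section Pohozaev

open Filter Topology Matrix

variable {n : ℕ} {S : Set (E n)} {u : E n → ℝ} {x : E n}

theorem pd_of_mem_nhds (hS : S ∈ 𝓝 x) (f : E n → ℝ) (i : Fin n) :
    pd S f i x = fderiv ℝ f x (EuclideanSpace.single i 1) := by
  rw [pd, fderivWithin_of_mem_nhds hS]

theorem pd_eventuallyEq (hS : S ∈ 𝓝 x) (f : E n → ℝ) (i : Fin n) :
    pd S f i =ᶠ[𝓝 x] fun y => fderiv ℝ f y (EuclideanSpace.single i 1) :=
  (eventually_mem_nhds_iff.2 hS).mono fun _ hy => pd_of_mem_nhds hy f i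

theorem contDiffAt_fderiv_apply {f : E n → ℝ} {r : WithTop ℕ∞} (hf : ContDiffAt ℝ (r + 1) f x)
    (v : E n) : ContDiffAt ℝ r (fun y => fderiv ℝ f y v) x :=
  (hf.fderiv_right le_rfl).clm_apply contDiffAt_const

theorem contDiffAt_pd {r : WithTop ℕ∞} (hS : S ∈ 𝓝 x) (hu : ContDiffAt ℝ (r + 1) u x) (i : Fin n) :
    ContDiffAt ℝ r (pd S u i) x :=
  (contDiffAt_fderiv_apply hu _).congr_of_eventuallyEq (pd_eventuallyEq hS u i)

theorem fderiv_fderiv_comm {f : E n → ℝ} (hf : ContDiffAt ℝ 2 f x) (v w : E n) :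
    fderiv ℝ (fun y => fderiv ℝ f y v) x w = fderiv ℝ (fun y => fderiv ℝ f y w) x v := by
  have hd : DifferentiableAt ℝ (fderiv ℝ f) x :=
    (hf.fderiv_right (m := 1) (by norm_num [one_add_one_eq_two])).differentiableAt (by simp)
  have hsymm : IsSymmSndFDerivAt ℝ f x := hf.isSymmSndFDerivAt (by simp)
  rw [fderiv_clm_apply hd (by fun_prop), fderiv_clm_apply hd (by fun_prop)]
  simpa using hsymm.eq w v

theorem pd_comm (hS : S ∈ 𝓝 x) (hu : ContDiffAt ℝ 2 u x) (i j : Fin n) :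
    pd S (pd S u j) i x = pd S (pd S u i) j x := by
  rw [pd_of_mem_nhds hS, pd_of_mem_nhds hS, (pd_eventuallyEq hS u j).fderiv_eq,
    (pd_eventuallyEq hS u i).fderiv_eq, fderiv_fderiv_comm hu]

/-- The function `x · ∂u - u`; it is the coefficient of `g` in `D²u - u g = ∂²u + (x · ∂u - u) g`. -/
def legendre (S : Set (E n)) (u : E n → ℝ) (x : E n) : ℝ := ∑ m, x m * pd S u m x - u x

/-- The endomorphism field `gⁱˡ (u_lj - u g_lj)`. -/
def hessEnd (S : Set (E n)) (u : E n → ℝ) (x : E n) : Matrix (Fin n) (Fin n) ℝ :=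
  (hypMetric x)⁻¹ * shiftedHess S u x

theorem shiftedHess_apply (S : Set (E n)) (u : E n → ℝ) (x : E n) (i j : Fin n) :
    shiftedHess S u x i j = pd S (pd S u j) i x + legendre S u x * hypMetric x i j := by
  have h : ∑ k, christoffel hypMetric k i j x * pd S u k x =
      - (∑ k, x k * pd S u k x) * hypMetric x i j := by
    simp_rw [christoffel_hypMetric, neg_mul, Finset.sum_mul, Finset.sum_neg_distrib]
    exact congrArg _ (Finset.sum_congr rfl fun k _ => by ring)
  rw [shiftedHess, Matrix.sub_apply, hess, Matrix.of_apply, h, Matrix.smul_apply, smul_eq_mul,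
    legendre]
  ring

theorem hypMetric_mul_hessEnd (S : Set (E n)) (u : E n → ℝ) (x : E n) :
    hypMetric x * hessEnd S u x = shiftedHess S u x := by
  rw [hessEnd, ← Matrix.mul_assoc, hypMetric_inv, hypMetric_mul_hypInv, Matrix.one_mul]

theorem hessEnd_apply (S : Set (E n)) (u : E n → ℝ) (x : E n) (l j : Fin n) :
    hessEnd S u x l j = pd S (pd S u j) l x + x l * ∑ m, x m * pd S (pd S u j) m x
      + legendre S u x * (1 : Matrix (Fin n) (Fin n) ℝ) l j := by
  have h : shiftedHess S u x = Matrix.of (fun i j => pd S (pd S u j) i x)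
      + legendre S u x • hypMetric x := by
    ext i j; simp [shiftedHess_apply]
  rw [hessEnd, hypMetric_inv, h, Matrix.mul_add, Matrix.mul_smul, hypInv_mul_hypMetric]
  simp [Matrix.mul_apply, hypInv_apply, add_mul, Finset.sum_add_distrib, Matrix.one_apply,
    Finset.mul_sum, mul_assoc]

theorem hypMetric_transpose (x : E n) : (hypMetric x)ᵀ = hypMetric x := by
  ext i j
  simp [hypMetric_apply, Matrix.one_apply, eq_comm, mul_comm]

theorem S_k_eq {k : ℕ} (hk : k ≤ n) (S : Set (E n)) (u : E n → ℝ) (x : E n) :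
    S_k k S u x = esym k (hessEnd S u x) := by
  rw [S_k, sigmaT, sigma_eq_esym hk, hessEnd]

theorem gradSq_eq (S : Set (E n)) (u : E n → ℝ) (x : E n) :
    gradSq hypMetric S u x = ∑ i, pd S u i x ^ 2 + (∑ i, x i * pd S u i x) ^ 2 := by
  have h : ∀ i j, hypInv x i j * pd S u i x * pd S u j x =
      (1 : Matrix (Fin n) (Fin n) ℝ) i j * pd S u i x * pd S u j x
        + (x i * pd S u i x) * (x j * pd S u j x) := fun i j => by rw [hypInv_apply]; ring
  rw [gradSq, hypMetric_inv]
  simp_rw [h, Finset.sum_add_distrib, sq (∑ i, x i * pd S u i x), Finset.sum_mul_sum]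
  simp [Matrix.one_apply, sq]

/-- If `A` is self-adjoint with respect to the symmetric form `G`, then so are its Newton
tensors. -/
theorem transpose_mul_newton {G A : Matrix (Fin n) (Fin n) ℝ} (hG : Gᵀ = G)
    (hA : (G * A)ᵀ = G * A) (k : ℕ) : (G * newton k A)ᵀ = G * newton k A := by
  induction k with
  | zero => simpa [newton_zero] using hG
  | succ k ih =>
    rw [Matrix.transpose_mul, hG] at hA ih
    have h1 := newton_succ_add_mul k A
    have h2 := newton_succ_add_mul' k A
    rw [Matrix.transpose_mul, hG]
    conv_lhs => rw [eq_sub_of_add_eq h1]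
    rw [eq_sub_of_add_eq h2, Matrix.transpose_sub, Matrix.transpose_mul, Matrix.sub_mul,
      Matrix.mul_assoc, hA, ← Matrix.mul_assoc, ih, Matrix.mul_sub]
    simp [Matrix.mul_assoc]

theorem transpose_hypMetric_mul_newton (hS : S ∈ 𝓝 x) (hu : ContDiffAt ℝ 2 u x) (k : ℕ) :
    (hypMetric x * newton k (hessEnd S u x))ᵀ = hypMetric x * newton k (hessEnd S u x) := by
  refine transpose_mul_newton (hypMetric_transpose x) ?_ k
  rw [hypMetric_mul_hessEnd]
  ext i j
  rw [Matrix.transpose_apply, shiftedHess_apply, shiftedHess_apply, pd_comm hS hu,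
    ← Matrix.transpose_apply (hypMetric x), hypMetric_transpose]

theorem contDiff_coord {r : WithTop ℕ∞} (i : Fin n) : ContDiff ℝ r (fun y : E n => y i) :=
  (EuclideanSpace.proj i : E n →L[ℝ] ℝ).contDiff

theorem contDiffAt_legendre {r : WithTop ℕ∞} (hS : S ∈ 𝓝 x) (hu : ContDiffAt ℝ (r + 1) u x) :
    ContDiffAt ℝ r (legendre S u) x :=
  (ContDiffAt.sum fun m _ => (contDiff_coord m).contDiffAt.mul (contDiffAt_pd hS hu m)).sub
    (hu.of_le le_self_add)

theorem differentiableAt_pd (hS : S ∈ 𝓝 x) (hu : ContDiffAt ℝ 2 u x) (i : Fin n) :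
    DifferentiableAt ℝ (pd S u i) x :=
  (contDiffAt_pd (r := 1) hS (by norm_num [one_add_one_eq_two, hu]) i).differentiableAt (by simp)

theorem differentiableAt_legendre (hS : S ∈ 𝓝 x) (hu : ContDiffAt ℝ 2 u x) :
    DifferentiableAt ℝ (legendre S u) x :=
  (contDiffAt_legendre (r := 1) hS (by norm_num [one_add_one_eq_two, hu])).differentiableAt (by simp)

theorem fderiv_legendre (hS : S ∈ 𝓝 x) (hu : ContDiffAt ℝ 2 u x) (j : Fin n) :
    fderiv ℝ (legendre S u) x (EuclideanSpace.single j 1) = ∑ m, x m * pd S (pd S u m) j x := by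
  have hu1 : DifferentiableAt ℝ u x := hu.differentiableAt (by simp)
  have h : HasFDerivAt (legendre S u) _ x :=
    (HasFDerivAt.fun_sum (u := Finset.univ) fun m _ =>
      (hasFDerivAt_coord m x).mul (differentiableAt_pd hS hu m).hasFDerivAt).sub hu1.hasFDerivAt
  rw [h.fderiv]
  simp [← pd_of_mem_nhds hS, Finset.sum_add_distrib]

/-- The vector field `∂u + x (x · ∂u - u)`. -/
def shiftedGrad (S : Set (E n)) (u : E n → ℝ) (l : Fin n) (x : E n) : ℝ :=
  pd S u l x + x l * legendre S u x

/-- In the chart, `g⁻¹ (D²u - u g)` is a Jacobian matrix. -/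
theorem hessEnd_eq_fderiv (hS : S ∈ 𝓝 x) (hu : ContDiffAt ℝ 2 u x) (l j : Fin n) :
    hessEnd S u x l j = fderiv ℝ (shiftedGrad S u l) x (EuclideanSpace.single j 1) := by
  have h : HasFDerivAt (shiftedGrad S u l) _ x := (differentiableAt_pd hS hu l).hasFDerivAt.add
    ((hasFDerivAt_coord l x).mul (differentiableAt_legendre hS hu).hasFDerivAt)
  rw [h.fderiv, hessEnd_apply, pd_comm hS hu]
  simp_rw [pd_comm hS hu _ j]
  simp [fderiv_legendre hS hu, ← pd_of_mem_nhds hS, Matrix.one_apply]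
  ring

theorem contDiffAt_shiftedGrad {r : WithTop ℕ∞} (hS : S ∈ 𝓝 x) (hu : ContDiffAt ℝ (r + 1) u x)
    (l : Fin n) : ContDiffAt ℝ r (shiftedGrad S u l) x :=
  (contDiffAt_pd hS hu l).add ((contDiff_coord l).contDiffAt.mul (contDiffAt_legendre hS hu))

theorem hessEnd_eventuallyEq (hS : S ∈ 𝓝 x) (hu : ContDiffAt ℝ 2 u x) (l j : Fin n) :
    (fun y => hessEnd S u y l j) =ᶠ[𝓝 x]
      fun y => fderiv ℝ (shiftedGrad S u l) y (EuclideanSpace.single j 1) := by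
  filter_upwards [eventually_mem_nhds_iff.2 hS, hu.eventually (by simp)] with y hy hy2
  exact hessEnd_eq_fderiv hy hy2 l j

theorem differentiableAt_hessEnd (hS : S ∈ 𝓝 x) (hu : ContDiffAt ℝ 3 u x) (l j : Fin n) :
    DifferentiableAt ℝ (fun y => hessEnd S u y l j) x := by
  have h2 : ContDiffAt ℝ 2 (shiftedGrad S u l) x :=
    contDiffAt_shiftedGrad hS (by norm_num [two_add_one_eq_three, hu]) l
  refine ((contDiffAt_fderiv_apply (r := 1) (f := shiftedGrad S u l) ?_
    _).differentiableAt (by simp)).congr_of_eventuallyEq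
    (hessEnd_eventuallyEq hS (hu.of_le (by norm_num)) l j)
  norm_num [one_add_one_eq_two, h2]

/-- The Codazzi equation: in the chart, the derivative of `g⁻¹ (D²u - u g)` is symmetric. -/
theorem fderiv_hessEnd_comm (hS : S ∈ 𝓝 x) (hu : ContDiffAt ℝ 3 u x) (i j l : Fin n) :
    fderiv ℝ (fun y => hessEnd S u y l j) x (EuclideanSpace.single i 1) =
      fderiv ℝ (fun y => hessEnd S u y l i) x (EuclideanSpace.single j 1) := by
  have hu2 : ContDiffAt ℝ 2 u x := hu.of_le (by norm_num)
  rw [(hessEnd_eventuallyEq hS hu2 l j).fderiv_eq, (hessEnd_eventuallyEq hS hu2 l i).fderiv_eq]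
  exact fderiv_fderiv_comm (contDiffAt_shiftedGrad hS (by norm_num [two_add_one_eq_three, hu]) l) _ _

/-- The Newton tensors of `g⁻¹ (D²u - u g)` are divergence free in the chart. -/
theorem sum_fderiv_newton_hessEnd (hS : S ∈ 𝓝 x) (hu : ContDiffAt ℝ 3 u x) (k : ℕ) (j : Fin n) :
    ∑ i, fderiv ℝ (fun y => newton k (hessEnd S u y) i j) x (EuclideanSpace.single i 1) = 0 :=
  sum_fderiv_newton_eq_zero k (differentiableAt_hessEnd hS hu) _ (fderiv_hessEnd_comm hS hu) j

/-- `½ (|Du|² - u²)`. -/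
def energy (S : Set (E n)) (u : E n → ℝ) (x : E n) : ℝ :=
  (1 / 2) * (gradSq hypMetric S u x - u x ^ 2)

/-- `½ ∂_j (|Du|² - u²) = u_l A_lj`. -/
theorem differentiableAt_energy (hS : S ∈ 𝓝 x) (hu : ContDiffAt ℝ 2 u x) :
    DifferentiableAt ℝ (energy S u) x ∧ ∀ j, fderiv ℝ (energy S u) x (EuclideanSpace.single j 1) =
      ∑ l, pd S u l x * hessEnd S u x l j := by
  have hu1 : DifferentiableAt ℝ u x := hu.differentiableAt (by simp)
  have hpd := differentiableAt_pd hS hu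
  have h : HasFDerivAt (energy S u) _ x :=
    (((HasFDerivAt.fun_sum (u := Finset.univ) fun m _ => (hpd m).hasFDerivAt.pow 2).add
      ((HasFDerivAt.fun_sum (u := Finset.univ) fun m _ =>
      (hasFDerivAt_coord m x).mul (hpd m).hasFDerivAt).pow 2)).sub
      (hu1.hasFDerivAt.pow 2)).const_mul (1 / 2 : ℝ) |>.congr_of_eventuallyEq
      (Eventually.of_forall fun y => by simp [energy, gradSq_eq])
  refine ⟨h.differentiableAt, fun j => ?_⟩
  rw [h.fderiv]
  simp_rw [hessEnd_apply, legendre, pd_comm hS hu _ j]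
  simp [← pd_of_mem_nhds hS, Matrix.one_apply, mul_add, Finset.sum_add_distrib]
  simp_rw [← mul_assoc, ← Finset.sum_mul]
  rw [Finset.mul_sum]
  simp_rw [mul_comm (pd S u _ x) (x _)]
  simp_rw [mul_assoc (2 : ℝ), ← Finset.mul_sum]
  ring

/-! ### The divergence of the Pohozaev field -/

theorem hypMetric_mulVec_self (x : E n) :
    hypMetric x *ᵥ (fun i => x i) = (height x ^ 2)⁻¹ • (fun i => x i) := by
  have hne := (height_pos x).ne'
  have h : hypInv x *ᵥ (fun i => x i) = height x ^ 2 • (fun i => x i) := by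
    ext i
    have h1 : ∀ j, hypInv x i j * x j = (1 : Matrix (Fin n) (Fin n) ℝ) i j * x j + x i * x j ^ 2 :=
      fun j => by rw [hypInv_apply]; ring
    simp only [mulVec, dotProduct, h1, Finset.sum_add_distrib, ← Finset.mul_sum, Pi.smul_apply,
      smul_eq_mul, height_sq]
    simp [Matrix.one_apply]
    ring
  have h2 := congrArg (hypMetric x *ᵥ ·) h
  simp only [mulVec_mulVec, hypMetric_mul_hypInv, one_mulVec, mulVec_smul] at h2
  conv_rhs => rw [h2]
  rw [smul_smul, inv_mul_cancel₀ (by positivity), one_smul]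

theorem hypMetric_mulVec_gradV (p x : E n) :
    hypMetric x *ᵥ gradV p x = fun i => pd Set.univ (V p) i x := by
  rw [← hypInv_mulVec_pd_V, mulVec_mulVec, hypMetric_mul_hypInv, one_mulVec]

/-- The terms which the chart adds to the divergence of `T(DV)` cancel if `T` is self-adjoint. -/
theorem pd_V_dotProduct_mulVec {T : Matrix (Fin n) (Fin n) ℝ}
    (hT : (hypMetric x * T)ᵀ = hypMetric x * T) (p : E n) :
    (fun i => pd Set.univ (V p) i x) ⬝ᵥ T *ᵥ (fun i => x i) =
      (height x ^ 2)⁻¹ * ((fun i => x i) ⬝ᵥ T *ᵥ gradV p x) := by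
  have hx : (height x ^ 2)⁻¹ * ((fun i => x i) ⬝ᵥ T *ᵥ gradV p x) =
      (hypMetric x *ᵥ (fun i => x i)) ⬝ᵥ T *ᵥ gradV p x := by
    rw [hypMetric_mulVec_self, smul_dotProduct, smul_eq_mul]
  have hflip : ∀ v w : Fin n → ℝ, (hypMetric x *ᵥ v) ⬝ᵥ T *ᵥ w = v ⬝ᵥ (hypMetric x * T) *ᵥ w := by
    intro v w
    rw [← mulVec_mulVec, dotProduct_mulVec v, ← mulVec_transpose, hypMetric_transpose]
  rw [hx, ← hypMetric_mulVec_gradV, hflip, hflip, dotProduct_mulVec, ← mulVec_transpose, hT,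
    dotProduct_comm]

/-- In the chart, `∂_i (DV)_j = V δ_ij + x_j ∂_i V`. -/
theorem hasFDerivAt_gradV (p x : E n) (j : Fin n) :
    HasFDerivAt (fun y => gradV p y j) (V p x • EuclideanSpace.proj j + x j • fderiv ℝ (V p) x) x :=
  (((hasFDerivAt_V p x).differentiableAt.hasFDerivAt.mul (hasFDerivAt_coord j x)).sub_const (p j))

theorem hasFDerivAt_inv_height (x : E n) :
    HasFDerivAt (fun y : E n => (height y)⁻¹) (-(height x ^ 3)⁻¹ • innerSL ℝ x) x := by
  have hne := (height_pos x).ne'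
  refine ((hasDerivAt_inv hne).comp_hasFDerivAt x (hasFDerivAt_height x)).congr_fderiv ?_
  rw [smul_smul]
  congr 1
  field_simp

theorem differentiableAt_mulVec_gradV {T : E n → Matrix (Fin n) (Fin n) ℝ} {f : E n → ℝ}
    (hT : ∀ i j, DifferentiableAt ℝ (fun y => T y i j) x) (hf : DifferentiableAt ℝ f x) (p : E n)
    (i : Fin n) :
    DifferentiableAt ℝ (fun y => f y * (T y *ᵥ gradV p y) i * (height y)⁻¹) x :=
  (hf.mul (DifferentiableAt.fun_sum (u := Finset.univ) fun j _ =>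
    (hT i j).mul (hasFDerivAt_gradV p x j).differentiableAt)).mul
    (hasFDerivAt_inv_height x).differentiableAt

/-- The Riemannian divergence of `f T(DV)` for a self-adjoint endomorphism field `T` which is
divergence free in the chart: as `D²V = V g`, it is `f V tr T + df(T(DV))`. -/
theorem euclDiv_mulVec_gradV {T : E n → Matrix (Fin n) (Fin n) ℝ} {f : E n → ℝ}
    (hT : ∀ i j, DifferentiableAt ℝ (fun y => T y i j) x) (hf : DifferentiableAt ℝ f x)
    (hdiv : ∀ j, ∑ i, fderiv ℝ (fun y => T y i j) x (EuclideanSpace.single i 1) = 0)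
    (hsymm : (hypMetric x * T x)ᵀ = hypMetric x * T x) (p : E n) :
    height x * euclDiv (fun i y => f y * (T y *ᵥ gradV p y) i * (height y)⁻¹) x =
      f x * V p x * (T x).trace
        + ∑ i, fderiv ℝ f x (EuclideanSpace.single i 1) * (T x *ᵥ gradV p x) i := by
  have hne := (height_pos x).ne'
  have h : ∀ i, HasFDerivAt (fun y => f y * (T y *ᵥ gradV p y) i * (height y)⁻¹) _ x := fun i =>
    (hf.hasFDerivAt.mul (HasFDerivAt.fun_sum (u := Finset.univ) fun j _ =>
      (hT i j).hasFDerivAt.mul (hasFDerivAt_gradV p x j))).mul (hasFDerivAt_inv_height x)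
  have key := pd_V_dotProduct_mulVec hsymm p
  have hdiv2 : ∑ i, ∑ j, gradV p x j * fderiv ℝ (fun y => T y i j) x (EuclideanSpace.single i 1) = 0 := by
    rw [Finset.sum_comm]
    refine Finset.sum_eq_zero fun j _ => ?_
    rw [← Finset.mul_sum, hdiv, mul_zero]
  have hterm : ∀ i, height x * fderiv ℝ (fun y => f y * (T y *ᵥ gradV p y) i * (height y)⁻¹) x
      (EuclideanSpace.single i 1) =
      f x * V p x * T x i i + fderiv ℝ f x (EuclideanSpace.single i 1) * (T x *ᵥ gradV p x) i
      + f x * ∑ j, gradV p x j * fderiv ℝ (fun y => T y i j) x (EuclideanSpace.single i 1)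
      + f x * (pd Set.univ (V p) i x * ∑ j, T x i j * x j
        - (height x ^ 2)⁻¹ * (x i * (T x *ᵥ gradV p x) i)) := by
    intro i
    rw [(h i).fderiv]
    simp [← pd_univ, mulVec, dotProduct, Finset.sum_add_distrib, mul_add,
      EuclideanSpace.inner_single_right]
    simp_rw [← mul_assoc (T x i _), ← Finset.sum_mul]
    field_simp
    ring
  rw [euclDiv, Finset.mul_sum]
  simp_rw [hterm, Finset.sum_add_distrib, ← Finset.mul_sum]
  rw [hdiv2, Finset.sum_sub_distrib, ← Finset.mul_sum]
  simp only [dotProduct, mulVec] at key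
  simp only [mulVec, dotProduct, Matrix.trace, Matrix.diag]
  rw [key]
  ring

/-- The vector field `√(det g) (½ (|Du|² - u²) T_k(DV) - C u DV + u T_{k+1}(DV))`, where `T_k` are
the Newton tensors of `D²u - u I`. -/
def pohozaevField (k : ℕ) (C : ℝ) (S : Set (E n)) (u : E n → ℝ) (p : E n) (i : Fin n) (x : E n) :
    ℝ :=
  energy S u x * (newton k (hessEnd S u x) *ᵥ gradV p x) i * (height x)⁻¹
    + -(C * u x) * ((1 : Matrix (Fin n) (Fin n) ℝ) *ᵥ gradV p x) i * (height x)⁻¹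
    + u x * (newton (k + 1) (hessEnd S u x) *ᵥ gradV p x) i * (height x)⁻¹

theorem differentiableAt_newton_hessEnd (hS : S ∈ 𝓝 x) (hu : ContDiffAt ℝ 3 u x) (k : ℕ)
    (i j : Fin n) : DifferentiableAt ℝ (fun y => newton k (hessEnd S u y) i j) x :=
  differentiableAt_newton k (differentiableAt_hessEnd hS hu) i j

theorem differentiableAt_pohozaevField (hS : S ∈ 𝓝 x) (hu : ContDiffAt ℝ 3 u x) (k : ℕ) (C : ℝ)
    (p : E n) (i : Fin n) : DifferentiableAt ℝ (pohozaevField k C S u p i) x := by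
  have hu1 : DifferentiableAt ℝ u x := hu.differentiableAt (by simp)
  have hcu : DifferentiableAt ℝ (fun y => -(C * u y)) x := (hu1.const_mul C).neg
  exact ((differentiableAt_mulVec_gradV (differentiableAt_newton_hessEnd hS hu k)
    (differentiableAt_energy hS (hu.of_le (by norm_num))).1 p i).add
    (differentiableAt_mulVec_gradV (T := fun _ => 1) (fun _ _ => differentiableAt_const _)
      hcu p i)).add
    (differentiableAt_mulVec_gradV (differentiableAt_newton_hessEnd hS hu (k + 1)) hu1 p i)

/-- The divergence of the field, at a point where `σ_{k+1}(D²u - u I) = C`. -/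
theorem euclDiv_pohozaevField (hS : S ∈ 𝓝 x) (hu : ContDiffAt ℝ 3 u x) {k : ℕ} {C : ℝ}
    (hC : esym (k + 1) (hessEnd S u x) = C) (p : E n) :
    height x * euclDiv (pohozaevField k C S u p) x =
      energy S u x * V p x * (((n : ℝ) - k) * esym k (hessEnd S u x))
        - ((k : ℝ) + 1) * C * (u x * V p x) := by
  have hu1 : DifferentiableAt ℝ u x := hu.differentiableAt (by simp)
  have hu2 : ContDiffAt ℝ 2 u x := hu.of_le (by norm_num)
  obtain ⟨he, he'⟩ := differentiableAt_energy hS hu2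
  have hT := differentiableAt_newton_hessEnd hS hu
  have hI : ∀ i j : Fin n,
      DifferentiableAt ℝ (fun _ : E n => (1 : Matrix (Fin n) (Fin n) ℝ) i j) x :=
    fun _ _ => differentiableAt_const _
  have hcu : DifferentiableAt ℝ (fun y => -(C * u y)) x := (hu1.const_mul C).neg
  have hdiv := sum_fderiv_newton_hessEnd hS hu
  have hsymm := transpose_hypMetric_mul_newton hS hu2
  have hsplit : euclDiv (pohozaevField k C S u p) x =
      euclDiv (fun i y => energy S u y * (newton k (hessEnd S u y) *ᵥ gradV p y) i * (height y)⁻¹) x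
      + euclDiv (fun i y => -(C * u y) * ((1 : Matrix (Fin n) (Fin n) ℝ) *ᵥ gradV p y) i
          * (height y)⁻¹) x
      + euclDiv (fun i y => u y * (newton (k + 1) (hessEnd S u y) *ᵥ gradV p y) i
          * (height y)⁻¹) x := by
    simp only [euclDiv, ← Finset.sum_add_distrib]
    refine Finset.sum_congr rfl fun i _ => ?_
    have h1 := differentiableAt_mulVec_gradV (hT k) he p i
    have h2 := differentiableAt_mulVec_gradV hI hcu p i
    have h3 := differentiableAt_mulVec_gradV (hT (k + 1)) hu1 p i
    exact DFunLike.congr_fun ((h1.hasFDerivAt.add h2.hasFDerivAt).add h3.hasFDerivAt).fderiv _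
  rw [hsplit, mul_add, mul_add, euclDiv_mulVec_gradV (hT k) he (hdiv k) (hsymm k) p,
    euclDiv_mulVec_gradV hI hcu (by simp) (by simpa using hypMetric_transpose x) p,
    euclDiv_mulVec_gradV (hT (k + 1)) hu1 (hdiv (k + 1)) (hsymm (k + 1)) p]
  -- `A T_k + T_{k+1} = σ_{k+1} I` cancels the terms with the gradient of `u`.
  have hgrad : ∑ i, fderiv ℝ (energy S u) x (EuclideanSpace.single i 1)
        * (newton k (hessEnd S u x) *ᵥ gradV p x) i
      + ∑ i, fderiv ℝ u x (EuclideanSpace.single i 1)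
        * (newton (k + 1) (hessEnd S u x) *ᵥ gradV p x) i
      = C * ∑ i, fderiv ℝ u x (EuclideanSpace.single i 1) * gradV p x i := by
    have h := congrArg (fun M => (fun i => pd S u i x) ⬝ᵥ M *ᵥ gradV p x)
      (newton_succ_add_mul k (hessEnd S u x))
    simp only [add_mulVec, ← mulVec_mulVec, dotProduct_add, smul_mulVec, one_mulVec,
      dotProduct_smul, hC, smul_eq_mul] at h
    rw [dotProduct_mulVec _ (hessEnd S u x)] at h
    simp_rw [he', ← pd_of_mem_nhds hS]
    rw [add_comm]
    exact h
  have hcu' : ∀ i, fderiv ℝ (fun y => -(C * u y)) x (EuclideanSpace.single i 1) =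
      -(C * fderiv ℝ u x (EuclideanSpace.single i 1)) := fun i => by
    have h : HasFDerivAt (fun y => -(C * u y)) _ x := (hu1.hasFDerivAt.const_mul C).neg
    rw [h.fderiv]
    simp
  simp_rw [hcu', one_mulVec, neg_mul, Finset.sum_neg_distrib, mul_assoc C, ← Finset.mul_sum,
    ← hgrad]
  rw [trace_newton, trace_newton, hC, Matrix.trace_one, Fintype.card_fin]
  push_cast
  ring

/-! ### Continuity up to the boundary -/

theorem contDiffOn_pd {r : WithTop ℕ∞} (hS : UniqueDiffOn ℝ S) (hu : ContDiffOn ℝ (r + 1) u S)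
    (i : Fin n) : ContDiffOn ℝ r (pd S u i) S :=
  (hu.fderivWithin hS le_rfl).clm_apply contDiffOn_const

theorem continuousOn_coord (i : Fin n) : ContinuousOn (fun y : E n => y i) S :=
  (contDiff_coord (r := 0) i).continuous.continuousOn

theorem continuous_V (p : E n) : Continuous (V p) :=
  continuous_iff_continuousAt.2 fun x => (hasFDerivAt_V p x).continuousAt

theorem continuous_gradV (p : E n) (j : Fin n) : Continuous fun x => gradV p x j :=
  continuous_iff_continuousAt.2 fun x => (hasFDerivAt_gradV p x j).continuousAt

theorem continuous_inv_height : Continuous fun x : E n => (height x)⁻¹ :=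
  continuous_iff_continuousAt.2 fun x => (hasFDerivAt_inv_height x).continuousAt

theorem continuousOn_pd (hS : UniqueDiffOn ℝ S) (hu : ContDiffOn ℝ 2 u S) (i : Fin n) :
    ContinuousOn (pd S u i) S :=
  (contDiffOn_pd (r := 1) hS (by norm_num [one_add_one_eq_two, hu]) i).continuousOn

theorem continuousOn_gradSq (hS : UniqueDiffOn ℝ S) (hu : ContDiffOn ℝ 2 u S) :
    ContinuousOn (gradSq hypMetric S u) S := by
  rw [funext (gradSq_eq S u)]
  exact (continuousOn_finsetSum _ fun i _ => (continuousOn_pd hS hu i).pow 2).add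
    ((continuousOn_finsetSum _ fun i _ => (continuousOn_coord i).mul
      (continuousOn_pd hS hu i)).pow 2)

theorem continuousOn_hessEnd (hS : UniqueDiffOn ℝ S) (hu : ContDiffOn ℝ 2 u S) :
    ContinuousOn (hessEnd S u) S := by
  have h1 := continuousOn_pd hS hu
  have h2 : ∀ i j, ContinuousOn (pd S (pd S u j) i) S := fun i j =>
    (contDiffOn_pd (r := 0) hS (contDiffOn_pd (r := 1) hS
      (by norm_num [one_add_one_eq_two, hu]) j) i).continuousOn
  refine continuousOn_pi.2 fun l => continuousOn_pi.2 fun j => ?_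
  simp_rw [hessEnd_apply, legendre]
  exact ((h2 l j).add ((continuousOn_coord l).mul (continuousOn_finsetSum _ fun m _ =>
    (continuousOn_coord m).mul (h2 m j)))).add (((continuousOn_finsetSum _ fun m _ =>
    (continuousOn_coord m).mul (h1 m)).sub hu.continuousOn).mul continuousOn_const)

theorem continuousOn_pohozaevField (hS : UniqueDiffOn ℝ S) (hu : ContDiffOn ℝ 2 u S) (k : ℕ)
    (C : ℝ) (p : E n) (i : Fin n) : ContinuousOn (pohozaevField k C S u p i) S := by
  have hA := continuousOn_hessEnd hS hu
  have hN : ∀ k i j, ContinuousOn (fun y => newton k (hessEnd S u y) i j) S := fun k i j =>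
    ((continuous_newton k).matrix_elem i j).comp_continuousOn hA
  have hTZ : ∀ k i, ContinuousOn (fun y => (newton k (hessEnd S u y) *ᵥ gradV p y) i) S :=
    fun k i => continuousOn_finsetSum Finset.univ fun j _ => (hN k i j).mul (continuous_gradV p j).continuousOn
  have he : ContinuousOn (energy S u) S :=
    continuousOn_const.mul ((continuousOn_gradSq hS hu).sub (hu.continuousOn.pow 2))
  have hi : ContinuousOn (fun x : E n => (height x)⁻¹) S := continuous_inv_height.continuousOn
  unfold pohozaevField
  simp_rw [one_mulVec]
  exact (((he.mul (hTZ k i)).mul hi).add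
    (((continuousOn_const.mul hu.continuousOn).neg.mul (continuous_gradV p i).continuousOn).mul
      hi)).add ((hu.continuousOn.mul (hTZ (k + 1) i)).mul hi)

end Pohozaev

/-! ### Riemannian integrals in the chart -/

section RiemannianIntegrals

open Filter Topology Matrix

variable {n : ℕ} {Ω : Set (E n)} {x : E n}

theorem isBounded_of_hdist_le {c : E n} {R : ℝ} (h : ∀ x ∈ Ω, hdist c x ≤ R) :
    Bornology.IsBounded Ω := by
  have hc : 0 < height c - ‖c‖ := sub_pos.2 (norm_lt_height c)
  refine isBounded_iff_forall_norm_le.2 ⟨Real.cosh R / (height c - ‖c‖), fun x hx => ?_⟩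
  rw [le_div_iff₀ hc]
  have h1 := one_le_height_mul_sub_inner c x
  have h0 : 0 ≤ hdist c x := Real.arcosh_nonneg h1
  have h2 : height c * height x - inner ℝ c x ≤ Real.cosh R := by
    rw [← Real.cosh_arcosh h1]
    exact Real.cosh_le_cosh.2 ((abs_of_nonneg h0).trans_le ((h x hx).trans (le_abs_self R)))
  nlinarith [real_inner_le_norm c x, norm_lt_height x, height_pos c]

theorem setIntegral_riemVolume (hΩ : MeasurableSet Ω) (F : E n → ℝ) :
    ∫ x in Ω, F x ∂riemVolume hypMetric = ∫ x in Ω, (height x)⁻¹ * F x := by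
  have hd : (fun x : E n => ENNReal.ofReal (Real.sqrt (hypMetric x).det)) =
      fun x => ENNReal.ofReal (height x)⁻¹ := funext fun x => by rw [sqrt_det_hypMetric]
  rw [riemVolume, hd, setIntegral_withDensity_eq_setIntegral_toReal_smul₀
    continuous_inv_height.measurable.ennreal_ofReal.aemeasurable (by simp) F hΩ]
  simp_rw [ENNReal.toReal_ofReal (inv_nonneg.2 (height_pos _).le), smul_eq_mul]

/-- `gⁱʲ ν_i ν_j` for the Euclidean unit normal `ν`. -/
theorem sum_hypInv_mul_euclNormal (h : ‖euclNormal Ω x‖ = 1) :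
    ∑ a, ∑ b, (hypMetric x)⁻¹ a b * euclNormal Ω x a * euclNormal Ω x b =
      1 + (∑ a, x a * euclNormal Ω x a) ^ 2 := by
  have h1 : ∀ a b, hypInv x a b * euclNormal Ω x a * euclNormal Ω x b =
      (1 : Matrix (Fin n) (Fin n) ℝ) a b * euclNormal Ω x a * euclNormal Ω x b
        + (x a * euclNormal Ω x a) * (x b * euclNormal Ω x b) := fun a b => by
    rw [hypInv_apply]; ring
  have h2 : ∑ a, euclNormal Ω x a ^ 2 = 1 := by
    rw [← EuclideanSpace.real_norm_sq_eq, h, one_pow]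
  rw [hypMetric_inv, ← h2]
  simp_rw [h1, Finset.sum_add_distrib, sq (∑ a, x a * euclNormal Ω x a), Finset.sum_mul_sum]
  simp [Matrix.one_apply, sq]

/-- The density of the hyperbolic surface measure with respect to the Hausdorff measure. -/
theorem sqrt_det_tangential (h : ‖euclNormal Ω x‖ = 1) :
    Real.sqrt (tangentProj Ω x * hypMetric x * tangentProj Ω x
        + Matrix.of fun i j => euclNormal Ω x i * euclNormal Ω x j).det =
      (height x)⁻¹ * Real.sqrt (1 + (∑ a, x a * euclNormal Ω x a) ^ 2) := by
  have h2 : (fun i => euclNormal Ω x i) ⬝ᵥ (fun i => euclNormal Ω x i) = 1 := by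
    have := EuclideanSpace.real_norm_sq_eq (euclNormal Ω x)
    rw [h, one_pow] at this
    simp [dotProduct, this, sq]
  have h3 : (fun i => euclNormal Ω x i) ⬝ᵥ hypInv x *ᵥ (fun i => euclNormal Ω x i) =
      1 + (∑ a, x a * euclNormal Ω x a) ^ 2 := by
    rw [← sum_hypInv_mul_euclNormal h, hypMetric_inv]
    simp only [dotProduct, mulVec, Finset.mul_sum]
    exact Finset.sum_congr rfl fun a _ => Finset.sum_congr rfl fun b _ => by ring
  rw [tangentProj, det_tangential (hypInv_mul_hypMetric x) h2, h3,
    Real.sqrt_mul (by rw [det_hypMetric]; positivity), sqrt_det_hypMetric]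

theorem integral_riemSurface (hΩ : IsOpen Ω) (hb : ∀ x ∈ frontier Ω, ∃ ρ, IsLocalDefining Ω x ρ)
    (F : E n → ℝ) : ∫ x, F x ∂riemSurface hypMetric Ω =
      ∫ x in frontier Ω, (height x)⁻¹ * Real.sqrt (1 + (∑ a, x a * euclNormal Ω x a) ^ 2) * F x
        ∂μHE[n - 1] := by
  have hν := fun x hx => sqrt_det_tangential (norm_euclNormal (hb x hx))
  have hm : MeasurableSet (frontier Ω) := isClosed_frontier.measurableSet
  have hc : ContinuousOn (fun x => (height x)⁻¹ *
      Real.sqrt (1 + (∑ a, x a * euclNormal Ω x a) ^ 2)) (frontier Ω) := by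
    refine continuous_inv_height.continuousOn.mul (Real.continuous_sqrt.comp_continuousOn
      (continuousOn_const.add ((continuousOn_finsetSum _ fun a _ =>
        (continuousOn_coord a).mul ?_).pow 2)))
    exact (contDiff_coord (r := 0) a).continuous.comp_continuousOn (continuousOn_euclNormal hΩ hb)
  rw [riemSurface, integral_withDensity_eq_integral_toReal_smul₀
    ((hc.congr hν).aemeasurable hm).ennreal_ofReal (by simp)]
  refine setIntegral_congr_fun hm fun x hx => ?_
  dsimp only
  rw [ENNReal.toReal_ofReal (Real.sqrt_nonneg _), hν x hx, smul_eq_mul]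

/-- Where `u = 0`, the boundary term times the density of the hyperbolic surface measure is twice the
Euclidean normal component of the field: the square root in the density cancels against the
normalization of the conormal. -/
theorem boundaryIntegrand_eq {u : E n → ℝ} (h : ‖euclNormal Ω x‖ = 1) (hu : u x = 0) {k : ℕ}
    (hk : k + 1 ≤ n) (C : ℝ) (p : E n) :
    (height x)⁻¹ * Real.sqrt (1 + (∑ a, x a * euclNormal Ω x a) ^ 2)
        * boundaryIntegrand (k + 1) Ω u p x =
      2 * ∑ j, pohozaevField k C (closure Ω) u p j x * euclNormal Ω x j := by
  set w := Real.sqrt (1 + (∑ a, x a * euclNormal Ω x a) ^ 2) with hw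
  have hw0 : w ≠ 0 := (Real.sqrt_pos.2 (by positivity)).ne'
  have hsum : ∑ i, ∑ j, sigmaD (k + 1) (hypMetric x) (shiftedHess (closure Ω) u x) i j
      * pd Set.univ (V p) i x * conormal hypMetric Ω x j =
      w⁻¹ * ∑ j, (newton k (hessEnd (closure Ω) u x) *ᵥ gradV p x) j * euclNormal Ω x j := by
    rw [Finset.sum_comm, Finset.mul_sum]
    refine Finset.sum_congr rfl fun j _ => ?_
    rw [← Finset.sum_mul, conormal, sum_hypInv_mul_euclNormal h, ← hw, ← hypInv_mulVec_pd_V,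
      mulVec_mulVec, ← hypMetric_inv, hessEnd]
    simp_rw [sigmaD_eq hk]
    simp only [mulVec, dotProduct]
    ring
  rw [boundaryIntegrand, hsum]
  simp only [pohozaevField, energy, hu, Finset.mul_sum, Finset.sum_mul]
  refine Finset.sum_congr rfl fun j _ => ?_
  field_simp
  ring

end RiemannianIntegrals

end HypPohozaev

end

open HypPohozaev

theorem lemma4p3 (n k : ℕ) (hk1 : 1 ≤ k) (hkn : k ≤ n)
    (Ω : Set (HypPohozaev.E n)) (hΩ : HypPohozaev.IsBoundedC2Domain Ω)
    (u : HypPohozaev.E n → ℝ)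
    (hu3 : ContDiffOn ℝ 3 u Ω) (hu2 : ContDiffOn ℝ 2 u (closure Ω))
    (heq : ∀ x ∈ Ω, HypPohozaev.S_k k (closure Ω) u x = (n.choose k : ℝ))
    (hbd : ∀ x ∈ frontier Ω, u x = 0)
    (p : HypPohozaev.E n) :
    (1 / 2 : ℝ) * (∫ x, HypPohozaev.boundaryIntegrand k Ω u p x
        ∂(HypPohozaev.riemSurface HypPohozaev.hypMetric Ω))
      = - (((n : ℝ) - k + 1) / 2) * (∫ x in Ω,
            HypPohozaev.S_k (k - 1) (closure Ω) u x * u x ^ 2 * HypPohozaev.V p x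
            ∂(HypPohozaev.riemVolume HypPohozaev.hypMetric))
        - (k : ℝ) * (n.choose k : ℝ) * (∫ x in Ω, u x * HypPohozaev.V p x
            ∂(HypPohozaev.riemVolume HypPohozaev.hypMetric))
        + (((n : ℝ) - k + 1) / 2) * (∫ x in Ω,
            HypPohozaev.S_k (k - 1) (closure Ω) u x
              * HypPohozaev.gradSq HypPohozaev.hypMetric (closure Ω) u x * HypPohozaev.V p x
            ∂(HypPohozaev.riemVolume HypPohozaev.hypMetric)) := by
  obtain ⟨d, rfl⟩ : ∃ d, n = d + 1 := ⟨n - 1, by omega⟩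
  obtain ⟨m, rfl⟩ : ∃ m, k = m + 1 := ⟨k - 1, by omega⟩
  have hop := hΩ.isOpen
  have hdef := hΩ.boundary
  have hmeas : MeasurableSet Ω := hop.measurableSet
  obtain ⟨c, R, hcR⟩ := hΩ.bounded
  have hbnd : Bornology.IsBounded Ω := HypPohozaev.isBounded_of_hdist_le hcR
  have hcomp : IsCompact (closure Ω) := hbnd.isCompact_closure
  have huniq := HypPohozaev.uniqueDiffOn_closure hop hdef
  set C : ℝ := ((d + 1).choose (m + 1) : ℝ)
  set S := closure Ω with hS
  have hnhds : ∀ x ∈ Ω, S ∈ nhds x := fun x hx => Filter.mem_of_superset (hop.mem_nhds hx) subset_closure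
  have hu3' : ∀ x ∈ Ω, ContDiffAt ℝ 3 u x := fun x hx => hu3.contDiffAt (hop.mem_nhds hx)
  rw [integral_riemSurface hop hdef, setIntegral_riemVolume hmeas, setIntegral_riemVolume hmeas,
    setIntegral_riemVolume hmeas, add_tsub_cancel_right, Nat.add_sub_cancel]
  have hSk : ∀ x, S_k m S u x = esym m (hessEnd S u x) := S_k_eq (by omega) S u
  simp_rw [hSk]
  have hint : ∀ F : E (d + 1) → ℝ, ContinuousOn F S →
      IntegrableOn (fun x => (height x)⁻¹ * F x) Ω := fun F hF =>
    ((continuous_inv_height.continuousOn.mul hF).integrableOn_compact hcomp).mono_set subset_closure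
  have hcV : ContinuousOn (V p) S := (continuous_V p).continuousOn
  have hcσ : ContinuousOn (fun x => esym m (hessEnd S u x)) S :=
    (continuous_esym m).comp_continuousOn (continuousOn_hessEnd huniq hu2)
  have hi1 := hint _ ((hcσ.mul (hu2.continuousOn.pow 2)).mul hcV)
  have hi2 := hint _ (hu2.continuousOn.mul hcV)
  have hi3 := hint _ ((hcσ.mul (continuousOn_gradSq huniq hu2)).mul hcV)
  have hdiv : ∀ x ∈ Ω, euclDiv (pohozaevField m C S u p) x =
      -(((d : ℝ) + 1 - (m + 1) + 1) / 2) *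
        ((height x)⁻¹ * (esym m (hessEnd S u x) * u x ^ 2 * V p x))
      - ((m : ℝ) + 1) * C * ((height x)⁻¹ * (u x * V p x))
      + (((d : ℝ) + 1 - (m + 1) + 1) / 2) *
        ((height x)⁻¹ * (esym m (hessEnd S u x) * gradSq hypMetric S u x * V p x)) := by
    intro x hx
    have hC : esym (m + 1) (hessEnd S u x) = C := by rw [← S_k_eq hkn, heq x hx]
    have h := euclDiv_pohozaevField (hnhds x hx) (hu3' x hx) hC p
    rw [mul_comm, ← eq_div_iff (height_pos x).ne'] at h
    rw [h, energy]
    push_cast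
    ring
  have hidiv : IntegrableOn (euclDiv (pohozaevField m C S u p)) Ω :=
    IntegrableOn.congr_fun (((hi1.const_mul _).sub (hi2.const_mul _)).add (hi3.const_mul _))
      (fun x hx => (hdiv x hx).symm) hmeas
  have hthm := divergence_theorem hop hbnd hdef (continuousOn_pohozaevField huniq hu2 m C p)
    (fun j x hx => differentiableAt_pohozaevField (hnhds x hx) (hu3' x hx) m C p j) hidiv
  have hleft : ∫ x in frontier Ω, (height x)⁻¹ *
      Real.sqrt (1 + (∑ a, x a * euclNormal Ω x a) ^ 2) * boundaryIntegrand (m + 1) Ω u p x ∂μHE[d]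
      = 2 * ∫ x in frontier Ω, ∑ j, pohozaevField m C S u p j x * euclNormal Ω x j ∂μHE[d] := by
    rw [← integral_const_mul]
    exact setIntegral_congr_fun isClosed_frontier.measurableSet fun x hx =>
      boundaryIntegrand_eq (norm_euclNormal (hdef x hx)) (hbd x hx) hkn C p
  rw [hleft, ← hthm, setIntegral_congr_fun hmeas hdiv, integral_add, integral_sub,
    integral_const_mul, integral_const_mul, integral_const_mul]
  · push_cast
    ring
  · exact hi1.const_mul _
  · exact hi2.const_mul _
  · exact (hi1.const_mul _).sub (hi2.const_mul _)
  · exact hi3.const_mul _
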